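/- **Theorem.** Let $\mathbf d$ and $\mathbf b$ be Turing degrees (of subsets of $\omega$). 1. If $\mathbf d$ is uniformly high for descending sequences and $\mathbf b$ is PA over $\mathbf d$, then $\mathbf b$ is uniformly high for isomorphism. 2. If $\mathbf d$ is uniformly high for descending sequences, then $\mathbf d$ computes every $\Delta^1_1$ subset of $\omega$. Here $\{e\}^D$ is the $e$-th partial $D$-computable function $\omega\rightharpoonup\omega$. A computable structure is a structure in a computable first-order language (with finitely or countably many symbols) whose domain is a computable subset of $\omega$ and whose functions and relations are uniformly computable; an index of it is an index of a partial computable function that computes the language, the domain, the functions and the relations. Indices of computable linear orders are defined in the same way. * $\mathbf d$ is *uniformly high for descending sequences* if there are $D\in\mathbf d$ and a total computable function $f$ such that, for every index $e$ of an ill-founded computable linear order $\mathcal L_e$, the function $\{f(e)\}^D$ is total and is an infinite strictly descending sequence in $\mathcal L_e$. * $\mathbf b$ is *uniformly high for isomorphism* if there are $B\in\mathbf b$ and a total computable function $f$ such that, for all indices $i,j$ of isomorphic computable structures $\mathcal M_i\cong\mathcal M_j$ in the same language, the function $\{f(i,j)\}^B$ is an isomorphism from $\mathcal M_i$ to $\mathcal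 M_j$. * $\mathbf b$ is *PA over* $\mathbf d$ if every infinite $\mathbf d$-computable tree $T\subseteq 2^{<\omega}$ has a $\mathbf b$-computable infinite path. * $X\subseteq\omega$ is $\Sigma^1_1$ if there is a computable relation $R\subseteq\omega\times\omega^{<\omega}$ such that $n\in X\iff\exists f\in\omega^\omega\ \forall k\ R(n,f\restriction k)$ for all $n$; it is $\Delta^1_1$ if both $X$ and $\omega\setminus X$ are $\Sigma^1_1$. -/

import Mathlib

open Classical in
/-- The characteristic function of `D`, as the total function `ℕ →. ℕ` used as an oracle. -/
noncomputable def charFn (D : Set ℕ) : ℕ →. ℕ :=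
  fun n => Part.some (if n ∈ D then 1 else 0)

/-- Turing reducibility between sets of natural numbers. -/
def SetTuringLE (A B : Set ℕ) : Prop := TuringReducible (charFn A) (charFn B)

instance SetTuringLE.instIsPreorder : IsPreorder (Set ℕ) SetTuringLE where
  refl A := TuringReducible.refl (charFn A)
  trans _ _ _ h₁ h₂ := TuringReducible.trans h₁ h₂

/-- Turing degrees: equivalence classes of sets of natural numbers under Turing equivalence. -/
abbrev SetDegree : Type := Antisymmetrization (Set ℕ) SetTuringLE

/-- `D ∈ d`. -/
def SetDegree.Mem (d : SetDegree) (D : Set ℕ) : Prop := toAntisymmetrization SetTuringLE D = d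

/-- The function `g` is `d`-computable. -/
def SetDegree.Computes {α σ : Type} [Primcodable α] [Primcodable σ] (d : SetDegree)
    (g : α → σ) : Prop :=
  ∃ D : Set ℕ, d.Mem D ∧ ComputableIn {charFn D} g

open Classical in
/-- The set `X` (a subset of `ℕ`, of the finite binary strings, ...) is `d`-computable. -/
def SetDegree.ComputesSet {α : Type} [Primcodable α] (d : SetDegree) (X : Set α) : Prop :=
  d.Computes (fun a => decide (a ∈ X))

/-- Programs for partial recursive functions with an oracle. -/
inductive OracleCode : Type
  | zero : OracleCode
  | succ : OracleCode
  | left : OracleCode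
  | right : OracleCode
  | oracle : OracleCode
  | pair : OracleCode → OracleCode → OracleCode
  | comp : OracleCode → OracleCode → OracleCode
  | prec : OracleCode → OracleCode → OracleCode
  | rfind : OracleCode → OracleCode

/-- The partial function computed by a program with oracle `O`; the clauses are those of
`Nat.RecursiveIn`. -/
def OracleCode.eval (O : ℕ →. ℕ) : OracleCode → ℕ →. ℕ
  | zero => fun _ => Part.some 0
  | succ => fun n => Part.some (n + 1)
  | left => fun n => Part.some n.unpair.1
  | right => fun n => Part.some n.unpair.2
  | oracle => O
  | pair f h => fun n => Nat.pair <$> eval O f n <*> eval O h n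
  | comp f h => fun n => eval O h n >>= eval O f
  | prec f h => fun p =>
      Nat.rec (motive := fun _ => Part ℕ) (eval O f p.unpair.1)
        (fun y IH => IH >>= fun i => eval O h (Nat.pair p.unpair.1 (Nat.pair y i)))
        p.unpair.2
  | rfind f => fun a => Nat.rfind fun n => (fun m => decide (m = 0)) <$> eval O f (Nat.pair a n)

/-- The standard effective enumeration of all programs. -/
def OracleCode.ofNat : ℕ → OracleCode
  | 0 => zero
  | 1 => succ
  | 2 => left
  | 3 => right
  | 4 => oracle
  | n + 5 =>
    have hm : n / 4 < n + 5 := by omega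
    have _h1 : (n / 4).unpair.1 < n + 5 := lt_of_le_of_lt (Nat.unpair_left_le _) hm
    have _h2 : (n / 4).unpair.2 < n + 5 := lt_of_le_of_lt (Nat.unpair_right_le _) hm
    match n % 4 with
    | 0 => pair (ofNat (n / 4).unpair.1) (ofNat (n / 4).unpair.2)
    | 1 => comp (ofNat (n / 4).unpair.1) (ofNat (n / 4).unpair.2)
    | 2 => prec (ofNat (n / 4).unpair.1) (ofNat (n / 4).unpair.2)
    | _ => rfind (ofNat (n / 4))

/-- `{e}^D`, the `e`-th partial `D`-computable function. -/
noncomputable def oracleFn (e : ℕ) (D : Set ℕ) : ℕ →. ℕ :=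
  (OracleCode.ofNat e).eval (charFn D)

/-- `φ_e`, the `e`-th partial computable function. -/
def partFn (e : ℕ) : ℕ →. ℕ :=
  (Denumerable.ofNat Nat.Partrec.Code e).eval

/-- The first-order language with symbols numbered by natural numbers, described by `s`:
`s k = none` if there is no `k`-th symbol, `s k = some (Sum.inl n)` if the `k`-th symbol is an
`n`-ary function symbol (a constant if `n = 0`), and `s k = some (Sum.inr n)` if it is an `n`-ary
relation symbol. -/
def codedLanguage (s : ℕ → Option (ℕ ⊕ ℕ)) : FirstOrder.Language.{0, 0} where
  Functions n := {k : ℕ // s k = some (Sum.inl n)}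
  Relations n := {k : ℕ // s k = some (Sum.inr n)}

open Classical in
/-- `i` is an index of the given structure with domain `A ⊆ ℕ` in the language described by `s`:
`φ_i` computes the language, the domain, and (uniformly) all functions and relations.
A structure is computable if and only if it has an index. -/
def IsStructureIndex (i : ℕ) (s : ℕ → Option (ℕ ⊕ ℕ)) (A : Set ℕ)
    [(codedLanguage s).Structure A] : Prop :=
  (∀ k : ℕ, Encodable.encode (s k) ∈ partFn i (Nat.pair 0 k)) ∧
  (∀ x : ℕ, (if x ∈ A then 1 else 0) ∈ partFn i (Nat.pair 1 x)) ∧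
  (∀ (n : ℕ) (F : (codedLanguage s).Functions n) (a : Fin n → A),
    ((FirstOrder.Language.Structure.funMap F a : A) : ℕ) ∈
      partFn i (Nat.pair (F.1 + 2) (Encodable.encode (List.ofFn fun m => (a m : ℕ))))) ∧
  (∀ (n : ℕ) (R : (codedLanguage s).Relations n) (a : Fin n → A),
    (if FirstOrder.Language.Structure.RelMap R a then 1 else 0) ∈
      partFn i (Nat.pair (R.1 + 2) (Encodable.encode (List.ofFn fun m => (a m : ℕ)))))

/-- `d` is uniformly high for isomorphism: for some `D ∈ d` and some total computable `f`, whenever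
`i` and `j` are indices of isomorphic computable structures, `{f(i,j)}^D` is (with the right
domain) an isomorphism from the first to the second. -/
def UniformlyHighForIsomorphism (d : SetDegree) : Prop :=
  ∃ D : Set ℕ, d.Mem D ∧ ∃ f : ℕ → ℕ → ℕ, Computable₂ f ∧
    ∀ (s : ℕ → Option (ℕ ⊕ ℕ)) (A B : Set ℕ)
      [(codedLanguage s).Structure A] [(codedLanguage s).Structure B] (i j : ℕ),
      IsStructureIndex i s A → IsStructureIndex j s B →
      Nonempty ((codedLanguage s).Equiv A B) →
      ∃ g : (codedLanguage s).Equiv A B, ∀ x y : ℕ,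
        y ∈ oracleFn (f i j) D x ↔ ∃ hx : x ∈ A, y = (g ⟨x, hx⟩ : ℕ)

open Classical in
/-- `e` is an index of the linear order with domain `A ⊆ ℕ` and strict order relation `r`:
`φ_e` computes the domain and the order relation. -/
def IsLinearOrderIndex (e : ℕ) (A : Set ℕ) (r : A → A → Prop) : Prop :=
  IsStrictTotalOrder A r ∧
  (∀ x : ℕ, (if x ∈ A then 1 else 0) ∈ partFn e (Nat.pair 0 x)) ∧
  (∀ x y : A, (if r x y then 1 else 0) ∈ partFn e (Nat.pair 1 (Nat.pair (x : ℕ) (y : ℕ))))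

/-- `d` is uniformly high for descending sequences: for some `D ∈ d` and some total computable `f`,
whenever `e` is an index of an ill-founded computable linear order, `{f(e)}^D` is an infinite
descending sequence in it. -/
def UniformlyHighForDescendingSequences (d : SetDegree) : Prop :=
  ∃ D : Set ℕ, d.Mem D ∧ ∃ f : ℕ → ℕ, Computable f ∧
    ∀ (A : Set ℕ) (r : A → A → Prop) (e : ℕ),
      IsLinearOrderIndex e A r → ¬ WellFounded r →
      ∃ g : ℕ → A, (∀ n : ℕ, r (g (n + 1)) (g n)) ∧
        ∀ n : ℕ, (g n : ℕ) ∈ oracleFn (f e) D n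

/-- `b` is PA over `d`: `b` computes a path through every infinite `d`-computable
subtree of `2^{<ω}`. -/
def IsPAOver (b d : SetDegree) : Prop :=
  ∀ T : Set (List Bool), (∀ σ τ : List Bool, σ <+: τ → τ ∈ T → σ ∈ T) → T.Infinite →
    d.ComputesSet T →
    ∃ X : ℕ → Bool, b.Computes X ∧ ∀ n : ℕ, List.ofFn (fun m : Fin n => X m) ∈ T

/-- `X ⊆ ℕ` is (lightface) `Σ¹₁`: it is the projection of a `Π⁰₁` subset of `ℕ × ℕ^ℕ`. -/
def IsSigma11 (X : Set ℕ) : Prop :=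
  ∃ R : ℕ → List ℕ → Prop, ComputablePred (fun p : ℕ × List ℕ => R p.1 p.2) ∧
    ∀ n : ℕ, n ∈ X ↔ ∃ f : ℕ → ℕ, ∀ k : ℕ, R n (List.ofFn (fun m : Fin k => f m))

/-- `X ⊆ ℕ` is (lightface) `Δ¹₁`. -/
def IsDelta11 (X : Set ℕ) : Prop := IsSigma11 X ∧ IsSigma11 Xᶜ

/-!
# Uniformly finding descending sequences and isomorphisms

Let `D` be an oracle that finds descending sequences in ill-founded computable linear orders,
uniformly in an index of the order. Applied to Kleene–Brouwer orders, it finds, uniformly for a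
computable family of trees on `ℕ` with a path, a sequence of strings of the tree that descends in
this order (`FindsDescending`). Such a sequence converges to a path of the
tree (`exists_limit_of_kb`). The limit need not be computable from the sequence, but the first
entry of any nonempty string of the sequence bounds the first entry of the limit path
(`IsKBDescending.exists_path_head`).

Given trees `S` and `T`, put `S` to the left of `T` below a common root. A descending sequence that
enters `S` shows that `S` has a path, and one that never enters `S` shows that `T` has a path.
Running this search for both arrangements of the two trees gives a partial `D`-computable function
that chooses, from two trees at least one of which has a path, one with a path; it can diverge only
if both have one (`FindsDescending.exists_selector`).

* A `Δ¹₁` set and its complement are given by computable families of trees, exactly one of which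
  has a path at each number. So the selector always halts, and it decides the set
  (`FindsDescending.computableIn_of_isDelta11`).
* A degree that is PA over the degree of `D` computes a total extension of the `{0, 1}`-valued
  selector (`IsPAOver.exists_total_extension`), and where the selector diverges either choice is
  right. It also computes `D`. Hence it finds a path through a tree that has one, entry by entry:
  a descending sequence bounds the next entry, and the total selector finds a correct one among
  the finitely many candidates (`FindsDescending.exists_path_finder`). The
  isomorphisms between two structures with given indices are the paths through a computable tree
  of finite partial maps, together with their inverses, for which no conflict has yet been seen
  (`IsIsoCode.isoTree_seg`, `isIsoCode_of_isoTree`).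

Uniformity requires the enumeration and parametrization theorems for programs with an oracle
(`recursiveIn_oracleFn`, `exists_computable_oracleFn_eq`). The enumeration theorem is reduced to
ordinary computability by the use principle: a computation with oracle `D` is a computation with a
finite part of `D`, and an ordinary program simulates programs with finite oracles.
-/


/-! ### Closure properties of relative computability -/

namespace RecursiveIn

variable {α β γ σ : Type*} [Primcodable α] [Primcodable β] [Primcodable γ] [Primcodable σ]
variable {O : Set (ℕ →. ℕ)}

theorem comp {f : β →. σ} {g : α → β} (hf : RecursiveIn O f) (hg : ComputableIn O g) :
    RecursiveIn O fun a => f (g a) := by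
  refine (Nat.RecursiveIn.comp hf hg).of_eq fun n => ?_
  rcases e : Encodable.decode (α := α) n with - | a <;> simp [Encodable.encodek]

theorem bind {f : α →. β} {g : α → β →. σ} (hf : RecursiveIn O f) (hg : RecursiveIn₂ O g) :
    RecursiveIn O fun a => (f a).bind (g a) := by
  refine (Nat.RecursiveIn.comp hg
    (Nat.RecursiveIn.pair (Nat.Partrec.some.recursiveIn) hf)).of_eq fun n => ?_
  rcases e : Encodable.decode (α := α) n with - | a
  · simp [Seq.seq]
  · simp [Seq.seq, e, Encodable.encodek, Part.bind_map, Part.map_map]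
    exact (Part.map_bind _ _ _).symm

theorem map {f : α →. β} {g : α → β → σ} (hf : RecursiveIn O f) (hg : ComputableIn₂ O g) :
    RecursiveIn O fun a => (f a).map (g a) := by
  have := bind (g := fun a x => Part.some (g a x)) hf hg
  simpa [Part.bind_some_eq_map] using this

theorem nat_rec {f : α → ℕ} {g : α →. σ} {h : α → ℕ × σ →. σ} (hf : ComputableIn O f)
    (hg : RecursiveIn O g) (hh : RecursiveIn₂ O h) :
    RecursiveIn O fun a => (f a).rec (g a) fun y IH => IH.bind fun i => h a (y, i) := by
  refine (Nat.RecursiveIn.comp (Nat.RecursiveIn.prec hg hh)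
    (Nat.RecursiveIn.pair (Nat.Partrec.some.recursiveIn) hf)).of_eq fun n => ?_
  rcases e : Encodable.decode (α := α) n with - | a
  · simp [Seq.seq]
  · simp only [Seq.seq, e, Part.bind_eq_bind, Part.map_eq_map, Part.map_some, Part.bind_some,
      Part.coe_some, Nat.unpair_pair]
    induction f a with
    | zero => simp [e]
    | succ k ih => simp_all [Encodable.encodek, Part.bind_map, Part.map_bind]

theorem rfind {p : α → ℕ →. Bool} (hp : RecursiveIn₂ O p) :
    RecursiveIn O fun a => Nat.rfind (p a) := by
  have h01 : ComputableIn₂ O fun (_ : α × ℕ) (b : Bool) => cond b 0 1 :=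
    ((Primrec.dom_bool fun b => cond b 0 1).comp Primrec.snd).computableIn
  refine (Nat.RecursiveIn.rfind (RecursiveIn.map hp h01)).of_eq fun n => ?_
  rcases e : Encodable.decode (α := α) n with - | a
  · simp only [Nat.unpair_pair, Encodable.decode_prod_val, e]
    simp
    exact Nat.rfind_zero_none _ rfl
  · have : (fun m : ℕ => (p a m).map
      (((fun m => decide (m = 0)) ∘ Encodable.encode) ∘ fun b => cond b 0 1)) = p a := by
      funext m
      refine Part.map_id' (fun b => ?_) _
      cases b <;> rfl
    simp [e, Part.map_map]
    conv_rhs => rw [← this]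
    congr 1

end RecursiveIn

namespace ComputableIn

variable {α β γ σ : Type*} [Primcodable α] [Primcodable β] [Primcodable γ] [Primcodable σ]
variable {O : Set (ℕ →. ℕ)}

theorem comp {f : β → σ} {g : α → β} (hf : ComputableIn O f) (hg : ComputableIn O g) :
    ComputableIn O fun a => f (g a) :=
  RecursiveIn.comp (f := fun b => Part.some (f b)) hf hg

theorem pair {f : α → β} {g : α → γ} (hf : ComputableIn O f) (hg : ComputableIn O g) :
    ComputableIn O fun a => (f a, g a) := by
  refine (Nat.RecursiveIn.pair hf hg).of_eq fun n => ?_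
  rcases e : Encodable.decode (α := α) n with - | a <;> simp [Seq.seq]

theorem of_eq {f g : α → σ} (hf : ComputableIn O f) (H : ∀ a, f a = g a) : ComputableIn O g :=
  (funext H : f = g) ▸ hf

theorem nat_rec {f : α → ℕ} {g : α → σ} {h : α → ℕ × σ → σ} (hf : ComputableIn O f)
    (hg : ComputableIn O g) (hh : ComputableIn₂ O h) :
    ComputableIn O fun a =>
      Nat.rec (motive := fun _ => σ) (g a) (fun y IH => h a (y, IH)) (f a) := by
  have key : ∀ a m, (Nat.rec (motive := fun _ => Part σ) (Part.some (g a))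
      (fun y IH => IH.bind fun i => Part.some (h a (y, i))) m : Part σ) =
      Part.some (Nat.rec (motive := fun _ => σ) (g a) (fun y IH => h a (y, IH)) m) := by
    intro a m
    induction m with
    | zero => rfl
    | succ m ih => simp only [ih, Part.bind_some]
  exact (RecursiveIn.nat_rec (h := fun a q => Part.some (h a q)) hf hg hh).of_eq
    fun a => key a (f a)

end ComputableIn

/-! ### Programs with an oracle: indices and the universal program -/

namespace OracleCode

open Nat.Partrec (Code)

/-- The index of the program `pair (ofNat a) (ofNat b)`. -/
def pairIndex (a b : ℕ) : ℕ := 4 * Nat.pair a b + 5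

/-- The index of the program `comp (ofNat a) (ofNat b)`. -/
def compIndex (a b : ℕ) : ℕ := 4 * Nat.pair a b + 6

theorem ofNat_pairIndex (a b : ℕ) : ofNat (pairIndex a b) = pair (ofNat a) (ofNat b) := by
  have h1 : 4 * Nat.pair a b / 4 = Nat.pair a b := by omega
  have h2 : 4 * Nat.pair a b % 4 = 0 := by omega
  simp [pairIndex, ofNat, h1, h2]

theorem ofNat_compIndex (a b : ℕ) : ofNat (compIndex a b) = comp (ofNat a) (ofNat b) := by
  have h1 : (4 * Nat.pair a b + 1) / 4 = Nat.pair a b := by omega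
  have h2 : (4 * Nat.pair a b + 1) % 4 = 1 := by omega
  rw [compIndex, show 4 * Nat.pair a b + 6 = (4 * Nat.pair a b + 1) + 5 by omega]
  simp [ofNat, h1, h2]

theorem ofNat_surjective : Function.Surjective ofNat := by
  intro c
  induction c with
  | zero => exact ⟨0, by simp [ofNat]⟩
  | succ => exact ⟨1, by simp [ofNat]⟩
  | left => exact ⟨2, by simp [ofNat]⟩
  | right => exact ⟨3, by simp [ofNat]⟩
  | oracle => exact ⟨4, by simp [ofNat]⟩
  | pair _ _ iha ihb =>
    obtain ⟨a, rfl⟩ := iha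
    obtain ⟨b, rfl⟩ := ihb
    exact ⟨_, ofNat_pairIndex a b⟩
  | comp _ _ iha ihb =>
    obtain ⟨a, rfl⟩ := iha
    obtain ⟨b, rfl⟩ := ihb
    exact ⟨_, ofNat_compIndex a b⟩
  | prec _ _ iha ihb =>
    obtain ⟨a, rfl⟩ := iha
    obtain ⟨b, rfl⟩ := ihb
    refine ⟨(4 * Nat.pair a b + 2) + 5, ?_⟩
    have h1 : (4 * Nat.pair a b + 2) / 4 = Nat.pair a b := by omega
    have h2 : (4 * Nat.pair a b + 2) % 4 = 2 := by omega
    simp [ofNat, h1, h2]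
  | rfind _ iha =>
    obtain ⟨a, rfl⟩ := iha
    refine ⟨(4 * a + 3) + 5, ?_⟩
    have h1 : (4 * a + 3) / 4 = a := by omega
    have h2 : (4 * a + 3) % 4 = 3 := by omega
    simp [ofNat, h1, h2]

theorem exists_eval_eq {O f : ℕ →. ℕ} (hf : Nat.RecursiveIn {O} f) : ∃ c, eval O c = f := by
  induction hf with
  | zero => exact ⟨zero, rfl⟩
  | succ => exact ⟨succ, rfl⟩
  | left => exact ⟨left, rfl⟩
  | right => exact ⟨right, rfl⟩
  | oracle g hg => exact ⟨oracle, (Set.mem_singleton_iff.mp hg).symm⟩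
  | pair _ _ iha ihb =>
    obtain ⟨a, rfl⟩ := iha
    obtain ⟨b, rfl⟩ := ihb
    exact ⟨pair a b, rfl⟩
  | comp _ _ iha ihb =>
    obtain ⟨a, rfl⟩ := iha
    obtain ⟨b, rfl⟩ := ihb
    exact ⟨comp a b, rfl⟩
  | prec _ _ iha ihb =>
    obtain ⟨a, rfl⟩ := iha
    obtain ⟨b, rfl⟩ := ihb
    exact ⟨prec a b, rfl⟩
  | rfind _ iha =>
    obtain ⟨a, rfl⟩ := iha
    exact ⟨rfind a, rfl⟩

theorem mem_eval_comp {O : ℕ →. ℕ} {a b : OracleCode} {n v : ℕ} :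
    v ∈ eval O (comp a b) n ↔ ∃ x ∈ eval O b n, v ∈ eval O a x :=
  Part.mem_bind_iff

theorem mem_eval_rfind {O : ℕ →. ℕ} {a : OracleCode} {n v : ℕ} :
    v ∈ eval O (rfind a) n ↔ (∃ x ∈ eval O a (Nat.pair n v), decide (x = 0) = true) ∧
      ∀ {m}, m < v → ∃ x ∈ eval O a (Nat.pair n m), decide (x = 0) = false :=
  Nat.mem_rfind.trans (and_congr (Part.mem_map_iff _)
    (forall_congr' fun _ => forall_congr' fun _ => Part.mem_map_iff _))

/-- Evaluation is monotone in the oracle. -/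
theorem eval_mono {O O' : ℕ →. ℕ} (h : ∀ n, ∀ v ∈ O n, v ∈ O' n) (c : OracleCode) :
    ∀ n, ∀ v ∈ eval O c n, v ∈ eval O' c n := by
  induction c with
  | zero => exact fun n v hv => hv
  | succ => exact fun n v hv => hv
  | left => exact fun n v hv => hv
  | right => exact fun n v hv => hv
  | oracle => exact h
  | pair a b iha ihb =>
    intro n v hv
    simp only [eval, Seq.seq, Part.map_eq_map, Part.mem_bind_iff, Part.mem_map_iff,
      exists_exists_and_eq_and] at hv ⊢
    obtain ⟨x, hx, y, hy, rfl⟩ := hv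
    exact ⟨x, iha _ _ hx, y, ihb _ _ hy, rfl⟩
  | comp a b iha ihb =>
    intro n v hv
    rw [mem_eval_comp] at hv
    simp only [mem_eval_comp]
    obtain ⟨x, hx, hy⟩ := hv
    exact ⟨x, ihb _ _ hx, iha _ _ hy⟩
  | prec a b iha ihb =>
    intro n v hv
    simp only [eval] at hv ⊢
    generalize n.unpair.2 = k at hv ⊢
    induction k generalizing v with
    | zero => exact iha _ _ hv
    | succ k ih =>
      simp only [Part.bind_eq_bind, Part.mem_bind_iff] at hv ⊢
      obtain ⟨x, hx, hy⟩ := hv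
      exact ⟨x, ih _ hx, ihb _ _ hy⟩
  | rfind a iha =>
    intro n v hv
    rw [mem_eval_rfind] at hv
    simp only [mem_eval_rfind]
    obtain ⟨⟨x, hx, hx0⟩, h2⟩ := hv
    refine ⟨⟨x, iha _ _ hx, hx0⟩, fun hm => ?_⟩
    obtain ⟨y, hy, hy0⟩ := h2 hm
    exact ⟨y, iha _ _ hy, hy0⟩

/-- The use principle: a halting computation consults only part of its oracle. Here the oracle is
the union of an increasing sequence of partial functions. -/
theorem exists_mem_eval_of_mem {O : ℕ →. ℕ} {P : ℕ → ℕ →. ℕ}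
    (hP : ∀ s t, s ≤ t → ∀ n, ∀ v ∈ P s n, v ∈ P t n) (hO : ∀ n, ∀ v ∈ O n, ∃ s, v ∈ P s n)
    (c : OracleCode) : ∀ n, ∀ v ∈ eval O c n, ∃ s, v ∈ eval (P s) c n := by
  have mono : ∀ {s t}, s ≤ t → ∀ (c : OracleCode) {n v}, v ∈ eval (P s) c n →
      v ∈ eval (P t) c n := fun h c n v => eval_mono (hP _ _ h) c n v
  induction c with
  | zero => exact fun n v hv => ⟨0, hv⟩
  | succ => exact fun n v hv => ⟨0, hv⟩
  | left => exact fun n v hv => ⟨0, hv⟩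
  | right => exact fun n v hv => ⟨0, hv⟩
  | oracle => exact hO
  | pair a b iha ihb =>
    intro n v hv
    simp only [eval, Seq.seq, Part.map_eq_map, Part.mem_bind_iff, Part.mem_map_iff,
      exists_exists_and_eq_and] at hv ⊢
    obtain ⟨x, hx, y, hy, rfl⟩ := hv
    obtain ⟨s, hs⟩ := iha _ _ hx
    obtain ⟨t, ht⟩ := ihb _ _ hy
    exact ⟨max s t, x, mono (le_max_left _ _) _ hs, y, mono (le_max_right _ _) _ ht, rfl⟩
  | comp a b iha ihb =>
    intro n v hv
    rw [mem_eval_comp] at hv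
    simp only [mem_eval_comp]
    obtain ⟨x, hx, hy⟩ := hv
    obtain ⟨s, hs⟩ := ihb _ _ hx
    obtain ⟨t, ht⟩ := iha _ _ hy
    exact ⟨max s t, x, mono (le_max_left _ _) _ hs, mono (le_max_right _ _) _ ht⟩
  | prec a b iha ihb =>
    intro n v hv
    have mono' : ∀ {s t}, s ≤ t → ∀ {p q v}, v ∈ eval (P s) (prec a b) (Nat.pair p q) →
        v ∈ eval (P t) (prec a b) (Nat.pair p q) := fun h _ _ _ hv => mono h _ hv
    simp only [eval, Nat.unpair_pair] at hv mono' ⊢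
    generalize n.unpair.2 = k at hv ⊢
    induction k generalizing v with
    | zero => exact iha _ _ hv
    | succ k ih =>
      simp only [Part.bind_eq_bind, Part.mem_bind_iff] at hv ih ⊢
      obtain ⟨x, hx, hy⟩ := hv
      obtain ⟨s, hs⟩ := ih _ hx
      obtain ⟨t, ht⟩ := ihb _ _ hy
      exact ⟨max s t, x, mono' (le_max_left _ _) hs, mono (le_max_right _ _) _ ht⟩
  | rfind a iha =>
    intro n v hv
    rw [mem_eval_rfind] at hv
    simp only [mem_eval_rfind]
    obtain ⟨⟨x, hx, hx0⟩, h2⟩ := hv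
    obtain ⟨s, hs⟩ := iha _ _ hx
    have : ∀ k ≤ v, ∃ t, ∀ m < k, ∃ y ∈ eval (P t) a (Nat.pair n m), decide (y = 0) = false := by
      intro k
      induction k with
      | zero => exact fun _ => ⟨0, fun m hm => absurd hm (Nat.not_lt_zero m)⟩
      | succ k ih =>
        intro hk
        obtain ⟨t, ht⟩ := ih (by omega)
        obtain ⟨y, hy, hy0⟩ := h2 (m := k) (by omega)
        obtain ⟨t', ht'⟩ := iha _ _ hy
        refine ⟨max t t', fun m hm => ?_⟩
        rcases Nat.lt_succ_iff_lt_or_eq.mp hm with hm | rfl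
        · obtain ⟨z, hz, hz0⟩ := ht m hm
          exact ⟨z, mono (le_max_left _ _) _ hz, hz0⟩
        · exact ⟨y, mono (le_max_right _ _) _ ht', hy0⟩
    obtain ⟨t, ht⟩ := this v le_rfl
    refine ⟨max s t, ⟨x, mono (le_max_left _ _) _ hs, hx0⟩, fun {m} hm => ?_⟩
    obtain ⟨y, hy, hy0⟩ := ht m hm
    exact ⟨y, mono (le_max_right _ _) _ hy, hy0⟩

/-- The partial oracle that knows only the values listed in `L`. -/
def listOracle (L : List ℕ) : ℕ →. ℕ := fun n => Part.ofOption L[n]?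

/-- One step of the universal program on a compound program: `r` is the number of the constructor
and `q` codes the subprograms, which `c` is used to run. -/
def compoundStep (c : Code) (L : List ℕ) (r q x : ℕ) : Part ℕ :=
  let call : ℕ → ℕ →. ℕ := fun d y => c.eval (Encodable.encode (d, L, y))
  bif r == 0 then
    (call q.unpair.1 x).bind fun a => (call q.unpair.2 x).map (Nat.pair a)
  else bif r == 1 then (call q.unpair.2 x).bind fun y => call q.unpair.1 y
  else bif r == 2 then
    Nat.rec (motive := fun _ => Part ℕ) (call q.unpair.1 x.unpair.1)
      (fun y IH => IH.bind fun i => call q.unpair.2 (Nat.pair x.unpair.1 (Nat.pair y i)))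
      x.unpair.2
  else Nat.rfind fun n => (call q (Nat.pair x n)).map fun m => decide (m = 0)

/-- One step of the universal program: it runs the program of index `e` on `x` with oracle
`listOracle L`, using `c` to run programs of smaller index. -/
def universalStep (c : Code) (L : List ℕ) (e x : ℕ) : Part ℕ :=
  bif e == 0 then Part.some 0
  else bif e == 1 then Part.some (x + 1)
  else bif e == 2 then Part.some x.unpair.1
  else bif e == 3 then Part.some x.unpair.2
  else bif e == 4 then listOracle L x
  else compoundStep c L ((e - 5) % 4) ((e - 5) / 4) x

section

variable {α : Type*} [Primcodable α] {c : α → Code} {L : α → List ℕ} {d e r q x : α → ℕ}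

theorem primrec_eq_const (hd : Primrec d) (k : ℕ) : Computable fun a => d a == k :=
  (Primrec.beq.comp hd (Primrec.const k)).to_comp

theorem partrec_call (hc : Primrec c) (hL : Primrec L) (hd : Primrec d) (hx : Primrec x) :
    Partrec fun a => (c a).eval (Encodable.encode (d a, L a, x a)) :=
  Nat.Partrec.Code.eval_part.comp hc.to_comp
    (Primrec.encode.comp (hd.pair (hL.pair hx))).to_comp

theorem partrec_compoundStep (hc : Primrec c) (hL : Primrec L) (hr : Primrec r) (hq : Primrec q)
    (hx : Primrec x) : Partrec fun a => compoundStep (c a) (L a) (r a) (q a) (x a) := by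
  have hq1 := Primrec.fst.comp (Primrec.unpair.comp hq)
  have hq2 := Primrec.snd.comp (Primrec.unpair.comp hq)
  have hx1 := Primrec.fst.comp (Primrec.unpair.comp hx)
  have hx2 := Primrec.snd.comp (Primrec.unpair.comp hx)
  unfold compoundStep
  refine Partrec.cond (primrec_eq_const hr 0) ?_ <| Partrec.cond (primrec_eq_const hr 1) ?_ <|
    Partrec.cond (primrec_eq_const hr 2) ?_ ?_
  · refine (partrec_call hc hL hq1 hx).bind (Partrec.map (partrec_call (hc.comp .fst)
      (hL.comp .fst) (hq2.comp .fst) (hx.comp .fst)) ?_)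
    exact (Primrec₂.natPair.comp (Primrec.snd.comp .fst) Primrec.snd).to_comp
  · exact (partrec_call hc hL hq2 hx).bind (partrec_call (hc.comp .fst) (hL.comp .fst)
      (hq1.comp .fst) .snd)
  · refine Partrec.nat_rec hx2.to_comp (partrec_call hc hL hq1 hx1)
      (h := fun a yi => (c a).eval (Encodable.encode ((q a).unpair.2, L a,
        Nat.pair (x a).unpair.1 (Nat.pair yi.1 yi.2)))) ?_
    exact partrec_call (hc.comp .fst) (hL.comp .fst) (hq2.comp .fst)
      (Primrec₂.natPair.comp (hx1.comp .fst) (Primrec₂.natPair.comp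
        (Primrec.fst.comp .snd) (Primrec.snd.comp .snd)))
  · refine Partrec.rfind (Partrec.map (partrec_call (hc.comp .fst) (hL.comp .fst) (hq.comp .fst)
      (Primrec₂.natPair.comp (hx.comp .fst) .snd)) ?_)
    exact (Primrec.eq.decide.comp Primrec.snd (Primrec.const 0)).to_comp

theorem partrec_universalStep (hc : Primrec c) (hL : Primrec L) (he : Primrec e)
    (hx : Primrec x) : Partrec fun a => universalStep (c a) (L a) (e a) (x a) := by
  have h5 := Primrec.nat_sub.comp he (Primrec.const 5)
  unfold universalStep
  exact Partrec.cond (primrec_eq_const he 0) (Computable.const 0).partrec <|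
    Partrec.cond (primrec_eq_const he 1) (Primrec.succ.comp hx).to_comp.partrec <|
    Partrec.cond (primrec_eq_const he 2)
      (Primrec.fst.comp (Primrec.unpair.comp hx)).to_comp.partrec <|
    Partrec.cond (primrec_eq_const he 3)
      (Primrec.snd.comp (Primrec.unpair.comp hx)).to_comp.partrec <|
    Partrec.cond (primrec_eq_const he 4) (Primrec.list_getElem?.comp hL hx).to_comp.ofOption <|
    partrec_compoundStep hc hL (Primrec.nat_mod.comp h5 (Primrec.const 4))
      (Primrec.nat_div.comp h5 (Primrec.const 4)) hx

end

/-- There is a universal program for computations with finite oracles. It calls itself on the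
subprograms of the given program, by the recursion theorem. -/
theorem exists_universal : ∃ U : Code, ∀ e L x,
    U.eval (Encodable.encode (e, L, x)) = (ofNat e).eval (listOracle L) x := by
  have hz : Primrec fun p : Code × ℕ => Denumerable.ofNat (ℕ × List ℕ × ℕ) p.2 :=
    (Primrec.ofNat _).comp Primrec.snd
  obtain ⟨U, hU⟩ := Nat.Partrec.Code.fixed_point₂
    (partrec_universalStep Primrec.fst (Primrec.fst.comp (Primrec.snd.comp hz))
      (Primrec.fst.comp hz) (Primrec.snd.comp (Primrec.snd.comp hz))).to₂
  have hU' : ∀ e L x, U.eval (Encodable.encode (e, L, x)) = universalStep U L e x := by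
    intro e L x
    rw [congrFun hU]
    simp only [Denumerable.ofNat_encode]
  refine ⟨U, fun e => ?_⟩
  induction e using Nat.strong_induction_on with
  | _ e ih =>
    intro L x
    rw [hU']
    match e with
    | 0 => simp [universalStep, ofNat, eval]
    | 1 => simp [universalStep, ofNat, eval]
    | 2 => simp [universalStep, ofNat, eval]
    | 3 => simp [universalStep, ofNat, eval]
    | 4 => simp [universalStep, ofNat, eval]
    | n + 5 =>
      have hm : n / 4 < n + 5 := by omega
      have h1 : (n / 4).unpair.1 < n + 5 := lt_of_le_of_lt (Nat.unpair_left_le _) hm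
      have h2 : (n / 4).unpair.2 < n + 5 := lt_of_le_of_lt (Nat.unpair_right_le _) hm
      have hr : n % 4 = 0 ∨ n % 4 = 1 ∨ n % 4 = 2 ∨ n % 4 = 3 := by omega
      have e0 : (n + 5 == 0) = false := by simp
      have e1 : (n + 5 == 1) = false := by simp
      have e2 : (n + 5 == 2) = false := by simp
      have e3 : (n + 5 == 3) = false := by simp
      have e4 : (n + 5 == 4) = false := by simp
      simp only [universalStep, compoundStep, e0, e1, e2, e3, e4, cond_false, Nat.add_sub_cancel,
        ih _ h1, ih _ h2, ih _ hm]
      rcases hr with hr | hr | hr | hr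
      · simp [hr, ofNat, eval, Seq.seq, Part.bind_map]
      · simp [hr, ofNat, eval]
        rfl
      · simp [hr, ofNat, eval]
      · simp [hr, ofNat, eval]

end OracleCode

section

variable {D : Set ℕ}

/-- The index of a program with constant value `n`. -/
def OracleCode.constIndex (n : ℕ) : ℕ :=
  Nat.rec 0 (fun _ i => OracleCode.compIndex 1 i) n

theorem OracleCode.eval_constIndex (O : ℕ →. ℕ) (n x : ℕ) :
    (OracleCode.ofNat (constIndex n)).eval O x = Part.some n := by
  induction n with
  | zero => simp [constIndex, ofNat, eval]
  | succ n ih =>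
    have : constIndex (n + 1) = compIndex 1 (constIndex n) := rfl
    rw [this, ofNat_compIndex]
    simp [ofNat, eval, ih]

theorem OracleCode.computable_constIndex : Computable constIndex :=
  (Primrec.nat_rec₁ 0 (f := fun _ i => compIndex 1 i)
    (Primrec.nat_add.comp (Primrec.nat_mul.comp (Primrec.const 4)
      (Primrec₂.natPair.comp (Primrec.const 1) Primrec.snd)) (Primrec.const 6))).to_comp

theorem exists_oracleFn_eq {f : ℕ →. ℕ} (hf : RecursiveIn {charFn D} f) :
    ∃ e, oracleFn e D = f := by
  obtain ⟨c, hc⟩ := OracleCode.exists_eval_eq (RecursiveIn.iff_nat.1 hf)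
  obtain ⟨e, rfl⟩ := OracleCode.ofNat_surjective c
  exact ⟨e, hc⟩

/-- The parametrization theorem for programs with an oracle. -/
theorem exists_computable_oracleFn_eq {f : ℕ → ℕ →. ℕ} (hf : RecursiveIn₂ {charFn D} f) :
    ∃ i : ℕ → ℕ, Computable i ∧ ∀ n, oracleFn (i n) D = f n := by
  obtain ⟨e, he⟩ := exists_oracleFn_eq
    (RecursiveIn.comp hf (Computable.unpair.computableIn (O := {charFn D})))
  -- `2` and `3` are indices of the two projections, so `idIndex` is one of the identity.
  let idIndex := OracleCode.pairIndex 2 3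
  refine ⟨fun n => OracleCode.compIndex e (OracleCode.pairIndex (OracleCode.constIndex n) idIndex),
    ?_, fun n => ?_⟩
  · have h1 : Computable fun n : ℕ => OracleCode.pairIndex (OracleCode.constIndex n) idIndex :=
      (Primrec.nat_add.comp (Primrec.nat_mul.comp (Primrec.const 4)
        (Primrec₂.natPair.comp Primrec.id (Primrec.const idIndex))) (Primrec.const 5)).to_comp.comp
        OracleCode.computable_constIndex
    exact (Primrec.nat_add.comp (Primrec.nat_mul.comp (Primrec.const 4)
        (Primrec₂.natPair.comp (Primrec.const e) Primrec.id)) (Primrec.const 6)).to_comp.comp h1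
  · funext x
    have hid : (OracleCode.ofNat idIndex).eval (charFn D) x = Part.some x := by
      rw [OracleCode.ofNat_pairIndex]
      simp [OracleCode.ofNat, OracleCode.eval, Seq.seq]
    have hpair : (OracleCode.ofNat (OracleCode.pairIndex (OracleCode.constIndex n) idIndex)).eval
        (charFn D) x = Part.some (Nat.pair n x) := by
      rw [OracleCode.ofNat_pairIndex]
      simp [OracleCode.eval, hid, OracleCode.eval_constIndex, Seq.seq]
    rw [oracleFn, OracleCode.ofNat_compIndex]
    simp only [OracleCode.eval, hpair]
    refine (Part.bind_some _ _).trans ?_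
    have := congrFun he (Nat.pair n x)
    rw [oracleFn] at this
    simpa using this

open Classical in
/-- The first `s` values of the characteristic function of `D`. -/
noncomputable def charList (D : Set ℕ) (s : ℕ) : List ℕ :=
  (List.range s).map fun n => if n ∈ D then 1 else 0

open Classical in
theorem computableIn_charFn : ComputableIn {charFn D} fun n => if n ∈ D then 1 else 0 :=
  RecursiveIn.oracle (charFn D) rfl

open Classical in
theorem computableIn_charList : ComputableIn {charFn D} (charList D) := by
  have h : ComputableIn₂ {charFn D} fun (_ : ℕ) (q : ℕ × List ℕ) =>
      q.2 ++ [if q.1 ∈ D then 1 else 0] :=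
    Primrec.list_concat.computableIn₂.comp (ComputableIn.pair
      (Primrec.snd.comp Primrec.snd).computableIn
      (computableIn_charFn.comp (Primrec.fst.comp Primrec.snd).computableIn))
  refine (ComputableIn.nat_rec (f := id) ComputableIn.id (ComputableIn.const []) h).of_eq
    fun s => ?_
  induction s with
  | zero => rfl
  | succ s ih =>
    simp only [id] at ih ⊢
    rw [ih]
    simp [charList, List.range_succ]

open Classical in
theorem mem_listOracle_charList {s n v : ℕ} :
    v ∈ OracleCode.listOracle (charList D s) n ↔ n < s ∧ v ∈ charFn D n := by
  by_cases h : n < s <;> simp [OracleCode.listOracle, charList, charFn, h]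

theorem mem_oracleFn_iff {e x v : ℕ} :
    v ∈ oracleFn e D x ↔
      ∃ s, v ∈ (OracleCode.ofNat e).eval (OracleCode.listOracle (charList D s)) x := by
  constructor
  · refine OracleCode.exists_mem_eval_of_mem (fun s t h n v hv => ?_) (fun n v hv => ?_) _ _ _
    · rw [mem_listOracle_charList] at hv ⊢
      exact ⟨hv.1.trans_le h, hv.2⟩
    · exact ⟨n + 1, mem_listOracle_charList.2 ⟨n.lt_succ_self, hv⟩⟩
  · rintro ⟨s, hs⟩
    exact OracleCode.eval_mono (fun n v hv => (mem_listOracle_charList.1 hv).2) _ _ _ hs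

theorem computableIn_evaln {α : Type*} [Primcodable α] {O : Set (ℕ →. ℕ)} {k n : α → ℕ}
    (hk : ComputableIn O k) (c : Nat.Partrec.Code) (hn : ComputableIn O n) :
    ComputableIn O fun a => c.evaln (k a) (n a) :=
  ComputableIn.comp (f := fun p : ℕ × ℕ => c.evaln p.1 p.2)
    (Nat.Partrec.Code.primrec_evaln.comp
      ((Primrec.fst.pair (Primrec.const c)).pair Primrec.snd)).computableIn (hk.pair hn)

/-- Computations with oracle `D` are limits of `D`-computable finite approximations. -/
theorem exists_approximation (D : Set ℕ) :
    ∃ a : ℕ × ℕ → ℕ → Option ℕ, ComputableIn₂ {charFn D} a ∧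
      ∀ e x v, v ∈ oracleFn e D x ↔ ∃ s, a (e, x) s = some v := by
  obtain ⟨U, hU⟩ := OracleCode.exists_universal
  refine ⟨fun p s => U.evaln s.unpair.1
    (Encodable.encode (p.1, charList D s.unpair.2, p.2)), ?_, fun e x v => ?_⟩
  · have h1 : ComputableIn {charFn D} fun q : (ℕ × ℕ) × ℕ => q.2.unpair :=
      (Primrec.unpair.comp Primrec.snd).computableIn
    have h2 : ComputableIn {charFn D} fun q : (ℕ × ℕ) × ℕ =>
        (q.1.1, charList D q.2.unpair.2, q.1.2) :=
      ComputableIn.pair (Primrec.fst.comp Primrec.fst).computableIn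
        (ComputableIn.pair (computableIn_charList.comp (ComputableIn.snd.comp h1))
          (Primrec.snd.comp Primrec.fst).computableIn)
    exact computableIn_evaln (ComputableIn.fst.comp h1) U (Primrec.encode.computableIn.comp h2)
  · rw [mem_oracleFn_iff]
    simp only [← hU, Nat.Partrec.Code.evaln_complete, Option.mem_def]
    constructor
    · rintro ⟨s, k, h⟩
      exact ⟨Nat.pair k s, by simpa using h⟩
    · rintro ⟨s, h⟩
      exact ⟨_, _, h⟩

/-- The enumeration theorem for programs with an oracle. -/
theorem recursiveIn_oracleFn (D : Set ℕ) : RecursiveIn₂ {charFn D} fun e x => oracleFn e D x := by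
  obtain ⟨a, ha, h⟩ := exists_approximation D
  have h1 : RecursiveIn {charFn D} fun p : ℕ × ℕ =>
      Nat.rfind ((fun s => (a p s).isSome : ℕ → Bool) : ℕ →. Bool) :=
    RecursiveIn.rfind (Primrec.option_isSome.computableIn.comp ha)
  have h2 : RecursiveIn₂ {charFn D} fun (p : ℕ × ℕ) s => (Part.ofOption (a p s) : Part ℕ) :=
    RecursiveIn.comp (Partrec.recursiveIn (Computable.ofOption Computable.id)) ha
  refine (h1.bind h2).of_eq fun p => Part.ext fun v => ?_
  rw [h]
  simp only [Part.mem_bind_iff, Part.mem_ofOption, Option.mem_def]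
  constructor
  · rintro ⟨s, -, hs⟩
    exact ⟨s, hs⟩
  · rintro ⟨s, hs⟩
    obtain ⟨t, ht, -⟩ := Nat.rfind_min' (p := fun s => (a p s).isSome) (m := s) (by simp [hs])
    have ht' : (a p t).isSome = true := (Part.mem_some_iff.1 (Nat.rfind_spec ht)).symm
    obtain ⟨w, hw⟩ := Option.isSome_iff_exists.1 ht'
    refine ⟨t, ht, ?_⟩
    have e1 := (h p.1 p.2 v).2 ⟨s, hs⟩
    have e2 := (h p.1 p.2 w).2 ⟨t, hw⟩
    rwa [Part.mem_unique e1 e2]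

end

/-! ### Bounded quantifiers and computable predicates -/

section

variable {α β : Type*} [Primcodable α] [Primcodable β]

theorem PrimrecRel.forall_lt_left {R : ℕ → β → Prop} (hR : PrimrecRel R) :
    PrimrecRel fun n b => ∀ m < n, R m b :=
  (hR.forall_mem_list.comp (Primrec.list_range.comp Primrec.fst) Primrec.snd).of_eq
    fun q => by simp

theorem PrimrecRel.exists_lt_left {R : ℕ → β → Prop} (hR : PrimrecRel R) :
    PrimrecRel fun n b => ∃ m < n, R m b :=
  (hR.exists_mem_list.comp (Primrec.list_range.comp Primrec.fst) Primrec.snd).of_eq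
    fun q => by simp

end

section

theorem ComputablePred.comp {α β : Type*} [Primcodable α] [Primcodable β] {P : β → Prop}
    {f : α → β} (hP : ComputablePred P) (hf : Computable f) : ComputablePred fun a => P (f a) := by
  obtain ⟨inst, hP⟩ := hP
  exact ⟨fun a => inst (f a), hP.comp hf⟩

theorem ComputablePred.and {α : Type*} [Primcodable α] {P Q : α → Prop} (hP : ComputablePred P)
    (hQ : ComputablePred Q) : ComputablePred fun a => P a ∧ Q a := by
  obtain ⟨_, hP⟩ := hP
  obtain ⟨_, hQ⟩ := hQ
  exact ⟨inferInstance, (Primrec.and.to_comp.comp hP hQ).of_eq fun a => by simp⟩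

theorem ComputablePred.or {α : Type*} [Primcodable α] {P Q : α → Prop} (hP : ComputablePred P)
    (hQ : ComputablePred Q) : ComputablePred fun a => P a ∨ Q a := by
  obtain ⟨_, hP⟩ := hP
  obtain ⟨_, hQ⟩ := hQ
  exact ⟨inferInstance, (Primrec.or.to_comp.comp hP hQ).of_eq fun a => by simp⟩

theorem computableIn_forall_lt {α : Type*} [Primcodable α] {O : Set (ℕ →. ℕ)} {f : α → ℕ}
    {P : α → ℕ → Bool} (hf : ComputableIn O f) (hP : ComputableIn₂ O P) :
    ComputableIn O fun a => decide (∀ m < f a, P a m = true) := by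
  have hstep : ComputableIn₂ O fun (a : α) (q : ℕ × Bool) => q.2 && P a q.1 :=
    Primrec.and.computableIn₂.comp ((Primrec.snd.comp Primrec.snd).computableIn.pair
      (hP.comp (ComputableIn.fst.pair (Primrec.fst.comp Primrec.snd).computableIn)))
  have key : ∀ a n, Nat.rec (motive := fun _ => Bool) true
      (fun m b => b && P a m) n = decide (∀ m < n, P a m = true) := by
    intro a n
    induction n with
    | zero => simp
    | succ n ih => simp only [ih, Nat.forall_lt_succ_right, Bool.decide_and, Bool.decide_eq_true]
  exact (ComputableIn.nat_rec hf (ComputableIn.const true) hstep).of_eq fun a => key a (f a)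

theorem computablePred_forall_lt {α : Type*} [Primcodable α] {f : α → ℕ} {P : α → ℕ → Prop}
    (hf : Computable f) (hP : ComputablePred fun q : α × ℕ => P q.1 q.2) :
    ComputablePred fun a => ∀ m < f a, P a m := by
  obtain ⟨g, hg, hgP⟩ := ComputablePred.computable_iff.1 hP
  have hgP' : ∀ a m, P a m ↔ g (a, m) = true := fun a m => iff_of_eq (congrFun hgP (a, m))
  simp only [hgP']
  have := recursiveIn_empty_iff.1 (computableIn_forall_lt (O := ∅)
    (P := fun a m => g (a, m)) hf.computableIn hg.computableIn)
  exact ⟨Classical.decPred _, Computable.of_eq this fun a => by simp⟩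

end

/-! ### The Kleene–Brouwer order -/

section

/-- The initial segment of length `k` of `f`. -/
def seg (f : ℕ → ℕ) (k : ℕ) : List ℕ := List.ofFn fun m : Fin k => f m

@[simp] theorem length_seg (f : ℕ → ℕ) (k : ℕ) : (seg f k).length = k := by simp [seg]

theorem getElem?_seg (f : ℕ → ℕ) {k m : ℕ} (h : m < k) : (seg f k)[m]? = some (f m) := by
  simp [seg, h]

@[simp] theorem seg_zero (f : ℕ → ℕ) : seg f 0 = [] := rfl

theorem seg_succ (f : ℕ → ℕ) (k : ℕ) : seg f (k + 1) = f 0 :: seg (fun n => f (n + 1)) k := by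
  simp [seg, List.ofFn_succ]

theorem take_seg (f : ℕ → ℕ) {k m : ℕ} (h : m ≤ k) : (seg f k).take m = seg f m := by
  refine List.ext_getElem? fun i => ?_
  rw [List.getElem?_take]
  split_ifs with hi
  · rw [getElem?_seg f (hi.trans_le h), getElem?_seg f hi]
  · exact (List.getElem?_eq_none (by simpa using hi)).symm

/-- Some infinite sequence has all its initial segments in `Q`. -/
def HasPath (Q : List ℕ → Prop) : Prop := ∃ f : ℕ → ℕ, ∀ k, Q (seg f k)

/-- `σ` belongs to the largest tree contained in `Q`. -/
def InTree (Q : List ℕ → Prop) (σ : List ℕ) : Prop := ∀ m < σ.length + 1, Q (σ.take m)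

/-- A string as an infinite sequence, continued by `⊤` beyond its end. -/
def kbKey (σ : List ℕ) (m : ℕ) : WithTop ℕ := (σ[m]?).elim ⊤ fun a => (a : WithTop ℕ)

theorem kbKey_of_lt {σ : List ℕ} {m : ℕ} (h : m < σ.length) : kbKey σ m = (σ[m] : WithTop ℕ) := by
  simp [kbKey, h]

theorem kbKey_eq_top_iff {σ : List ℕ} {m : ℕ} : kbKey σ m = ⊤ ↔ σ.length ≤ m := by
  by_cases h : m < σ.length
  · simp [kbKey_of_lt h, h]
  · simp [kbKey, not_lt.1 h]

theorem kbKey_eq_iff {σ τ : List ℕ} {m : ℕ} : kbKey σ m = kbKey τ m ↔ σ[m]? = τ[m]? := by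
  unfold kbKey
  cases σ[m]? <;> cases τ[m]? <;> simp

theorem kbKey_injective : Function.Injective kbKey := fun _ _ h =>
  List.ext_getElem? fun _ => kbKey_eq_iff.1 (congrFun h _)

/-- The (strict) Kleene–Brouwer order: a proper extension precedes its prefixes, and otherwise
strings are compared at the first place where they differ. -/
def kb (σ τ : List ℕ) : Prop := toLex (kbKey σ) < toLex (kbKey τ)

theorem kb_def {σ τ : List ℕ} :
    kb σ τ ↔ ∃ m, (∀ j < m, kbKey σ j = kbKey τ j) ∧ kbKey σ m < kbKey τ m := Iff.rfl

theorem kb_iff {σ τ : List ℕ} : kb σ τ ↔ ∃ m < σ.length, (∀ j < m, σ[j]? = τ[j]?) ∧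
    (τ.length ≤ m ∨ σ.getD m 0 < τ.getD m 0) := by
  simp only [kb_def, kbKey_eq_iff]
  constructor
  · rintro ⟨m, hj, hm⟩
    have h : m < σ.length := by
      by_contra h
      exact not_top_lt (kbKey_eq_top_iff.2 (not_lt.1 h) ▸ hm)
    refine ⟨m, h, hj, ?_⟩
    by_cases h' : m < τ.length
    · rw [kbKey_of_lt h, kbKey_of_lt h', Nat.cast_lt] at hm
      exact Or.inr (by simpa [h, h'] using hm)
    · exact Or.inl (not_lt.1 h')
  · rintro ⟨m, h, hj, hm⟩
    refine ⟨m, hj, ?_⟩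
    by_cases h' : m < τ.length
    · rw [kbKey_of_lt h, kbKey_of_lt h', Nat.cast_lt]
      rcases hm with hm | hm
      · omega
      · simpa [h, h'] using hm
    · rw [kbKey_eq_top_iff.2 (not_lt.1 h'), kbKey_of_lt h]
      exact WithTop.coe_lt_top _

theorem primrecRel_kb : PrimrecRel kb := by
  have hagree : PrimrecRel fun (j : ℕ) (q : List ℕ × List ℕ) => q.1[j]? = q.2[j]? :=
    Primrec.eq.comp
      (Primrec.list_getElem?.comp (Primrec.fst.comp Primrec.snd) Primrec.fst)
      (Primrec.list_getElem?.comp (Primrec.snd.comp Primrec.snd) Primrec.fst)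
  have hall : PrimrecRel fun (m : ℕ) (q : List ℕ × List ℕ) => ∀ j < m, q.1[j]? = q.2[j]? :=
    hagree.forall_lt_left
  have hstep : PrimrecRel fun (m : ℕ) (q : List ℕ × List ℕ) => (∀ j < m, q.1[j]? = q.2[j]?) ∧
      (q.2.length ≤ m ∨ q.1.getD m 0 < q.2.getD m 0) :=
    PrimrecPred.and hall <| PrimrecPred.or
      (Primrec.nat_le.comp (Primrec.list_length.comp (Primrec.snd.comp Primrec.snd)) Primrec.fst)
      (Primrec.nat_lt.comp
        ((Primrec.list_getD 0).comp (Primrec.fst.comp Primrec.snd) Primrec.fst)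
        ((Primrec.list_getD 0).comp (Primrec.snd.comp Primrec.snd) Primrec.fst))
  exact (hstep.exists_lt_left.comp (Primrec.list_length.comp Primrec.fst) Primrec.id).of_eq
    fun q => kb_iff.symm

theorem kb_seg_succ (f : ℕ → ℕ) (k : ℕ) : kb (seg f (k + 1)) (seg f k) := by
  refine kb_iff.2 ⟨k, by simp, fun j hj => ?_, Or.inl (by simp)⟩
  rw [getElem?_seg f hj, getElem?_seg f (hj.trans k.lt_succ_self)]

/-- A descending sequence of strings in the Kleene–Brouwer order converges to an infinite sequence:
each coordinate is eventually non-increasing, hence eventually constant, and it cannot stabilize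
at `⊤` because then the strings themselves would be eventually constant. -/
theorem exists_limit_of_kb {σ : ℕ → List ℕ} (h : ∀ n, kb (σ (n + 1)) (σ n)) :
    ∃ f : ℕ → ℕ, ∀ m, ∃ K, ∀ k ≥ K, (σ k).take m = seg f m := by
  have hstab : ∀ m, ∃ K, ∀ k ≥ K, ∀ j < m, kbKey (σ k) j = kbKey (σ K) j := by
    intro m
    induction m with
    | zero => exact ⟨0, fun _ _ j hj => absurd hj j.not_lt_zero⟩
    | succ m ih =>
      obtain ⟨K, hK⟩ := ih
      have hanti : Antitone fun i => kbKey (σ (K + i)) m := by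
        refine antitone_nat_of_succ_le fun i => ?_
        obtain ⟨j, hj, hlt⟩ := kb_def.1 (h (K + i))
        have hmj : m ≤ j := by
          by_contra hc
          have h1 := hK (K + i + 1) (by omega) j (by omega)
          have h2 := hK (K + i) (by omega) j (by omega)
          exact hlt.ne (h1.trans h2.symm)
        rcases hmj.lt_or_eq with hmj | rfl
        · exact (hj m hmj).le
        · exact hlt.le
      obtain ⟨N, hN⟩ := WellFoundedLT.antitone_chain_condition hanti
      refine ⟨K + N, fun k hk j hj => ?_⟩
      rcases Nat.lt_succ_iff_lt_or_eq.1 hj with hj | rfl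
      · rw [hK k (by omega) j hj, hK (K + N) (by omega) j hj]
      · obtain ⟨i, rfl⟩ := Nat.exists_eq_add_of_le (show K ≤ k by omega)
        exact (hN i (by omega)).symm
  choose K hK using hstab
  have hlen : ∀ m, ∀ k ≥ K m, m ≤ (σ k).length := by
    intro m k hk
    by_contra hc
    obtain ⟨i, hi⟩ : ∃ i, m = i + 1 := ⟨m - 1, by omega⟩
    subst hi
    have htop : ∀ k ≥ K (i + 1), kbKey (σ k) i = ⊤ := by
      intro k' hk'
      rw [hK _ k' hk' i i.lt_succ_self, ← hK _ k hk i i.lt_succ_self, kbKey_eq_top_iff]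
      omega
    have h1 : kbKey (σ (k + 1)) = kbKey (σ k) := by
      funext j
      by_cases hj : j < i + 1
      · rw [hK _ k hk j hj, hK _ (k + 1) (by omega) j hj]
      · rw [kbKey_eq_top_iff.2, kbKey_eq_top_iff.2]
        · have := kbKey_eq_top_iff.1 (htop k hk)
          omega
        · have := kbKey_eq_top_iff.1 (htop (k + 1) (by omega))
          omega
    have h2 := h k
    rw [kb, h1] at h2
    exact lt_irrefl _ h2
  refine ⟨fun i => (σ (K (i + 1))).getD i 0, fun m => ⟨(Finset.range (m + 1)).sup K, ?_⟩⟩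
  intro k hk
  have hle : ∀ j ≤ m, K j ≤ k := fun j hj =>
    (Finset.le_sup (Finset.mem_range.2 (Nat.lt_succ_of_le hj))).trans hk
  refine List.ext_getElem? fun i => ?_
  rw [List.getElem?_take]
  split_ifs with hi
  · rw [getElem?_seg _ hi, kbKey_eq_iff.1 (hK (i + 1) k (hle _ hi) i i.lt_succ_self)]
    have := hlen (i + 1) (K (i + 1)) le_rfl
    simp [show i < (σ (K (i + 1))).length by omega]
  · exact (List.getElem?_eq_none (by simpa using hi)).symm

theorem kb.ne_nil {σ τ : List ℕ} (h : kb σ τ) : σ ≠ [] := by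
  rintro rfl
  obtain ⟨m, hm, -⟩ := kb_iff.1 h
  simp at hm

end

/-! ### Descending sequences, uniformly -/

section

theorem computablePred_inTree {α : Type*} [Primcodable α] {Q : α → List ℕ → Prop}
    (hQ : ComputablePred fun q : α × List ℕ => Q q.1 q.2) :
    ComputablePred fun q : α × List ℕ => InTree (Q q.1) q.2 := by
  have htake : Computable fun r : (α × List ℕ) × ℕ => (r.1.1, r.1.2.take r.2) :=
    ((Primrec.fst.comp Primrec.fst).pair
      (Primrec.list_take.comp Primrec.snd (Primrec.snd.comp Primrec.fst))).to_comp
  have hlen : Computable fun q : α × List ℕ => q.2.length + 1 :=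
    (Primrec.succ.comp (Primrec.list_length.comp Primrec.snd)).to_comp
  exact computablePred_forall_lt (P := fun (q : α × List ℕ) m => Q q.1 (q.2.take m)) hlen
    (hQ.comp htake)

/-- The domain of the Kleene–Brouwer order of the tree of `Q`, as a set of codes of strings. -/
def kbDomain (Q : List ℕ → Prop) : Set ℕ := {x | InTree Q (Denumerable.ofNat (List ℕ) x)}

/-- The Kleene–Brouwer order of the tree of `Q`, on codes of strings. -/
def kbRel (Q : List ℕ → Prop) (x y : kbDomain Q) : Prop :=
  kb (Denumerable.ofNat (List ℕ) x) (Denumerable.ofNat (List ℕ) y)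

theorem isStrictTotalOrder_kbRel (Q : List ℕ → Prop) :
    IsStrictTotalOrder (kbDomain Q) (kbRel Q) := by
  have hinj : Function.Injective fun x : kbDomain Q =>
      toLex (kbKey (Denumerable.ofNat (List ℕ) x)) := fun x y h =>
    Subtype.ext ((Denumerable.eqv (List ℕ)).symm.injective (kbKey_injective (toLex.injective h)))
  exact (⟨⟨_, hinj⟩, Iff.rfl⟩ : kbRel Q ↪r
    ((· < ·) : Lex (ℕ → WithTop ℕ) → Lex (ℕ → WithTop ℕ) → Prop)).isStrictTotalOrder

theorem exists_kb_index {Q : ℕ → List ℕ → Prop}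
    (hQ : ComputablePred fun q : ℕ × List ℕ => Q q.1 q.2) :
    ∃ e : ℕ → ℕ, Computable e ∧
      ∀ p, IsLinearOrderIndex (e p) (kbDomain (Q p)) (kbRel (Q p)) := by
  classical
  obtain ⟨_, hT⟩ := computablePred_inTree hQ
  obtain ⟨_, hkb⟩ := primrecRel_kb
  let val : ℕ → ℕ := fun z =>
    bif z.unpair.2.unpair.1 == 0 then
      (decide (InTree (Q z.unpair.1) (Denumerable.ofNat (List ℕ) z.unpair.2.unpair.2))).toNat
    else (decide (kb (Denumerable.ofNat (List ℕ) z.unpair.2.unpair.2.unpair.1)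
      (Denumerable.ofNat (List ℕ) z.unpair.2.unpair.2.unpair.2))).toNat
  have hval : Computable val := by
    have h1 : Primrec fun z : ℕ => z.unpair.1 := Primrec.fst.comp Primrec.unpair
    have h2 : Primrec fun z : ℕ => z.unpair.2 := Primrec.snd.comp Primrec.unpair
    have hb : Primrec Bool.toNat := Primrec.dom_bool _
    have hd : Primrec (Denumerable.ofNat (List ℕ)) := Primrec.ofNat _
    refine Computable.cond (Primrec.beq.comp (h1.comp h2) (Primrec.const 0)).to_comp
      (hb.to_comp.comp ((hT.comp (h1.pair (hd.comp (h2.comp h2))).to_comp).of_eq fun _ => by congr))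
      (hb.comp ((hkb.comp ((hd.comp (h1.comp (h2.comp h2))).pair
        (hd.comp (h2.comp (h2.comp h2))))).of_eq fun _ => by congr)).to_comp
  obtain ⟨c, hc⟩ := Nat.Partrec.Code.exists_code.1 (Partrec.nat_iff.1 hval.partrec)
  have hval' : ∀ p z, partFn (Encodable.encode (c.curry p)) z = Part.some (val (Nat.pair p z)) := by
    intro p z
    simp [partFn, Nat.Partrec.Code.eval_curry, hc]
  refine ⟨fun p => Encodable.encode (c.curry p), (Primrec.encode.comp
    (Nat.Partrec.Code.primrec₂_curry.comp (Primrec.const c) Primrec.id)).to_comp,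
    fun p => ⟨isStrictTotalOrder_kbRel _, fun x => ?_, fun x y => ?_⟩⟩
  · rw [hval', Part.mem_some_iff]
    by_cases h : InTree (Q p) (Denumerable.ofNat (List ℕ) x) <;> simp [val, kbDomain, h]
  · rw [hval', Part.mem_some_iff]
    by_cases h : kb (Denumerable.ofNat (List ℕ) x) (Denumerable.ofNat (List ℕ) y) <;>
      simp [val, kbRel, h]

theorem not_wellFounded_kbRel {Q : List ℕ → Prop} (h : HasPath Q) : ¬ WellFounded (kbRel Q) := by
  obtain ⟨f, hf⟩ := h
  intro hwf
  have hmem : ∀ k, Encodable.encode (seg f k) ∈ kbDomain Q := by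
    intro k m hm
    simp only [Denumerable.ofNat_encode, length_seg] at hm ⊢
    rw [take_seg f (Nat.lt_succ_iff.1 hm)]
    exact hf m
  refine (wellFounded_iff_isEmpty_descending_chain.1 hwf).false
    ⟨fun k => ⟨_, hmem k⟩, fun k => ?_⟩
  simpa [kbRel] using kb_seg_succ f k

/-- A sequence of strings in the tree of `Q`, descending in the Kleene–Brouwer order. -/
structure IsKBDescending (Q : List ℕ → Prop) (σ : ℕ → List ℕ) : Prop where
  kb_succ : ∀ n, kb (σ (n + 1)) (σ n)
  inTree : ∀ n, InTree Q (σ n)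

theorem IsKBDescending.exists_path {Q : List ℕ → Prop} {σ : ℕ → List ℕ}
    (h : IsKBDescending Q σ) :
    ∃ f : ℕ → ℕ, (∀ k, Q (seg f k)) ∧ ∀ m, ∃ K, ∀ k ≥ K, (σ k).take m = seg f m := by
  obtain ⟨f, hf⟩ := exists_limit_of_kb h.kb_succ
  refine ⟨f, fun m => ?_, hf⟩
  obtain ⟨K, hK⟩ := hf m
  have hlen : ((σ K).take m).length = m := by rw [hK K le_rfl, length_seg]
  rw [← hK K le_rfl]
  refine h.inTree K m ?_
  rw [List.length_take] at hlen
  omega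

theorem kbKey_zero_le {σ τ : List ℕ} (h : kb σ τ) : kbKey σ 0 ≤ kbKey τ 0 := by
  obtain ⟨m, hm, hlt⟩ := kb_def.1 h
  rcases Nat.eq_zero_or_pos m with rfl | h0
  · exact hlt.le
  · exact (hm 0 h0).le

theorem kbKey_zero_eq_coe_iff {σ : List ℕ} {a : ℕ} : kbKey σ 0 = a ↔ σ.head? = some a := by
  cases σ with
  | nil => simp [kbKey]
  | cons b σ =>
    simp only [kbKey, List.length_cons, Nat.zero_lt_succ, getElem?_pos, List.getElem_cons_zero,
      Option.elim_some, List.head?_cons, Option.some.injEq]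
    exact WithTop.coe_inj

/-- The first entries of a descending sequence bound the first entry of its limit path, which
they eventually attain. -/
theorem IsKBDescending.exists_path_head {Q : List ℕ → Prop} {σ : ℕ → List ℕ}
    (h : IsKBDescending Q σ) :
    ∃ f : ℕ → ℕ, (∀ k, Q (seg f k)) ∧ (∀ n a, (σ n).head? = some a → f 0 ≤ a) ∧
      ∃ n, (σ n).head? = some (f 0) := by
  obtain ⟨f, hf, hlim⟩ := h.exists_path
  obtain ⟨K, hK⟩ := hlim 1
  have hhead : ∀ k ≥ K, (σ k).head? = some (f 0) := by
    intro k hk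
    have := hK k hk
    rw [seg_succ, seg_zero] at this
    cases hσ : σ k with
    | nil => simp [hσ] at this
    | cons b ρ => simp_all
  refine ⟨f, hf, fun n a ha => ?_, K, hhead K le_rfl⟩
  have hanti : Antitone fun n => kbKey (σ n) 0 :=
    antitone_nat_of_succ_le fun n => kbKey_zero_le (h.kb_succ n)
  have h1 := hanti (le_max_left n K)
  simp only [kbKey_zero_eq_coe_iff.2 ha,
    kbKey_zero_eq_coe_iff.2 (hhead _ (le_max_right n K))] at h1
  exact WithTop.coe_le_coe.1 h1

/-- Oracles that find descending sequences in Kleene–Brouwer orders, uniformly. -/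
def FindsDescending (D : Set ℕ) : Prop :=
  ∀ Q : ℕ → List ℕ → Prop, ComputablePred (fun q : ℕ × List ℕ => Q q.1 q.2) →
    ∃ δ : ℕ → ℕ →. List ℕ, RecursiveIn₂ {charFn D} δ ∧
      ∀ p, HasPath (Q p) → ∃ σ, IsKBDescending (Q p) σ ∧ ∀ n, δ p n = Part.some (σ n)

theorem UniformlyHighForDescendingSequences.exists_findsDescending {d : SetDegree}
    (h : UniformlyHighForDescendingSequences d) : ∃ D, d.Mem D ∧ FindsDescending D := by
  obtain ⟨D, hD, f, hf, h⟩ := h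
  refine ⟨D, hD, fun Q hQ => ?_⟩
  obtain ⟨e, he, hidx⟩ := exists_kb_index hQ
  refine ⟨fun p n => (oracleFn (f (e p)) D n).map (Denumerable.ofNat (List ℕ)), ?_,
    fun p hp => ?_⟩
  · exact RecursiveIn.map (RecursiveIn.comp (recursiveIn_oracleFn D)
      (ComputableIn.pair ((hf.comp he).comp Computable.fst).computableIn ComputableIn.snd))
      ((Primrec.ofNat (List ℕ)).comp Primrec.snd).computableIn
  · obtain ⟨g, hg, hgn⟩ := h _ _ _ (hidx p) (not_wellFounded_kbRel hp)
    refine ⟨fun n => Denumerable.ofNat (List ℕ) (g n), ⟨fun n => hg n, fun n => (g n).2⟩,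
      fun n => ?_⟩
    change (oracleFn (f (e p)) D n).map _ = _
    rw [Part.eq_some_iff.2 (hgn n), Part.map_some]

end

/-! ### Choosing an ill-founded tree -/

section

/-- The tree with the two subtrees `S` (to the left, at `0`) and `T` (to the right, at `1`). -/
def joinTree (S T : List ℕ → Prop) (σ : List ℕ) : Prop :=
  σ = [] ∨ σ.head? = some 0 ∧ S σ.tail ∨ σ.head? = some 1 ∧ T σ.tail

theorem hasPath_joinTree {S T : List ℕ → Prop} (h : HasPath S ∨ HasPath T) :
    HasPath (joinTree S T) := by
  rcases h with ⟨f, hf⟩ | ⟨f, hf⟩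
  · refine ⟨fun n => Nat.casesOn n 0 f, fun k => ?_⟩
    cases k with
    | zero => exact Or.inl rfl
    | succ k => exact Or.inr (Or.inl (by simpa [seg_succ] using hf k))
  · refine ⟨fun n => Nat.casesOn n 1 f, fun k => ?_⟩
    cases k with
    | zero => exact Or.inl rfl
    | succ k => exact Or.inr (Or.inr (by simpa [seg_succ] using hf k))

theorem hasPath_left_of_joinTree {S T : List ℕ → Prop} {f : ℕ → ℕ}
    (hf : ∀ k, joinTree S T (seg f k)) (h0 : f 0 = 0) : HasPath S :=
  ⟨fun n => f (n + 1), fun k => by simpa [joinTree, seg_succ, h0] using hf (k + 1)⟩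

theorem hasPath_right_of_joinTree {S T : List ℕ → Prop} {f : ℕ → ℕ}
    (hf : ∀ k, joinTree S T (seg f k)) (h0 : f 0 ≠ 0) : HasPath T := by
  refine ⟨fun n => f (n + 1), fun k => ?_⟩
  have := hf (k + 1)
  simp only [joinTree, seg_succ, List.head?_cons, List.tail_cons, Option.some.injEq, h0,
    reduceCtorEq, false_and, false_or] at this
  exact this.2

theorem computablePred_joinTree {S T : ℕ → List ℕ → Prop}
    (hS : ComputablePred fun q : ℕ × List ℕ => S q.1 q.2)
    (hT : ComputablePred fun q : ℕ × List ℕ => T q.1 q.2) :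
    ComputablePred fun q : ℕ × List ℕ => joinTree (S q.1) (T q.1) q.2 := by
  have htail : Computable fun q : ℕ × List ℕ => (q.1, q.2.tail) :=
    (Primrec.fst.pair (Primrec.list_tail.comp Primrec.snd)).to_comp
  have hhead : ∀ a : ℕ, ComputablePred fun q : ℕ × List ℕ => q.2.head? = some a := fun a =>
    (Primrec.eq.comp (Primrec.list_head?.comp Primrec.snd) (Primrec.const _)).computablePred
  have hnil : ComputablePred fun q : ℕ × List ℕ => q.2 = [] :=
    (Primrec.eq.comp Primrec.snd (Primrec.const _)).computablePred
  exact hnil.or (((hhead 0).and (hS.comp htail)).or ((hhead 1).and (hT.comp htail)))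

/-- If a descending sequence in the order of `joinTree S T` ever enters `S`, then `S` has a path;
if it never does, then `T` has one. -/
theorem IsKBDescending.hasPath_of_joinTree {S T : List ℕ → Prop} {σ : ℕ → List ℕ}
    (h : IsKBDescending (joinTree S T) σ) :
    ((∃ n, (σ n).head? = some 0) → HasPath S) ∧ ((∀ n, (σ n).head? ≠ some 0) → HasPath T) := by
  obtain ⟨f, hf, hle, n, hn⟩ := h.exists_path_head
  refine ⟨fun ⟨m, hm⟩ => hasPath_left_of_joinTree hf (Nat.le_zero.1 (hle m 0 hm)), fun h0 =>
    hasPath_right_of_joinTree hf fun hf0 => h0 n (hf0 ▸ hn)⟩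

/-- A partial `D`-computable function that, given two trees at least one of which has a path,
chooses one that has; it may diverge only if both have. It runs through descending
sequences for `joinTree S T` and for `joinTree T S` until one of them enters its left subtree. -/
theorem FindsDescending.exists_selector {D : Set ℕ} (hD : FindsDescending D)
    {S T : ℕ → List ℕ → Prop}
    (hS : ComputablePred fun q : ℕ × List ℕ => S q.1 q.2)
    (hT : ComputablePred fun q : ℕ × List ℕ => T q.1 q.2) :
    ∃ h : ℕ →. Bool, RecursiveIn {charFn D} h ∧ ∀ p, HasPath (S p) ∨ HasPath (T p) →
      (true ∈ h p → HasPath (S p)) ∧ (false ∈ h p → HasPath (T p)) ∧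
      (¬ (h p).Dom → HasPath (S p) ∧ HasPath (T p)) := by
  obtain ⟨δ, hδ, hδσ⟩ := hD (fun p => joinTree (S p) (T p)) (computablePred_joinTree hS hT)
  obtain ⟨ε, hε, hετ⟩ := hD (fun p => joinTree (T p) (S p)) (computablePred_joinTree hT hS)
  let test : ℕ → ℕ →. Bool := fun p n =>
    (δ p n).bind fun σ => (ε p n).map fun τ =>
      decide (σ.head? = some 0) || decide (τ.head? = some 0)
  have hhead : Primrec fun σ : List ℕ => decide (σ.head? = some 0) :=
    Primrec.eq.decide.comp Primrec.list_head? (Primrec.const _)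
  have htest : RecursiveIn₂ {charFn D} test :=
    hδ.bind ((RecursiveIn.comp hε ComputableIn.fst).map (Primrec.or.comp
      (hhead.comp (Primrec.snd.comp Primrec.fst)) (hhead.comp Primrec.snd)).computableIn)
  refine ⟨fun p => (Nat.rfind (test p)).bind fun n => (δ p n).map fun σ =>
    decide (σ.head? = some 0), ?_, fun p hp => ?_⟩
  · exact (RecursiveIn.rfind htest).bind (hδ.map (hhead.comp Primrec.snd).computableIn)
  · obtain ⟨σ, hσ, hδn⟩ := hδσ p (hasPath_joinTree hp)
    obtain ⟨τ, hτ, hεn⟩ := hετ p (hasPath_joinTree hp.symm)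
    have htestn : ∀ n, test p n =
        Part.some (decide ((σ n).head? = some 0) || decide ((τ n).head? = some 0)) := by
      intro n
      simp only [test, hδn, hεn, Part.bind_some, Part.map_some]
    simp only [Part.mem_bind_iff, hδn, Part.map_some, Part.mem_some_iff]
    refine ⟨?_, ?_, fun hdom => ?_⟩
    · rintro ⟨n, -, hn⟩
      exact hσ.hasPath_of_joinTree.1 ⟨n, by simpa using hn⟩
    · rintro ⟨n, hn, hn0⟩
      have := Nat.rfind_spec hn
      rw [htestn, Part.mem_some_iff, ← hn0] at this
      exact hτ.hasPath_of_joinTree.1 ⟨n, by simpa using this⟩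
    · have hnone : ∀ n, (σ n).head? ≠ some 0 ∧ (τ n).head? ≠ some 0 := by
        intro n
        by_contra hn
        refine hdom ?_
        have : (Nat.rfind (test p)).Dom := by
          refine Nat.rfind_dom.2 ⟨n, ?_, fun {m} _ => ?_⟩
          · rw [htestn, Part.mem_some_iff, eq_comm, Bool.or_eq_true, decide_eq_true_eq,
              decide_eq_true_eq]
            tauto
          · rw [htestn]
            trivial
        exact ⟨this, trivial⟩
      exact ⟨hτ.hasPath_of_joinTree.2 fun n => (hnone n).2,
        hσ.hasPath_of_joinTree.2 fun n => (hnone n).1⟩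

/-- If exactly one of two trees has a path, the selector halts and tells which. -/
theorem FindsDescending.computableIn_of_isDelta11 {D X : Set ℕ} [DecidablePred (· ∈ X)]
    (hD : FindsDescending D) (hX : IsDelta11 X) :
    ComputableIn {charFn D} fun n => decide (n ∈ X) := by
  obtain ⟨⟨R, hR, hXR⟩, ⟨R', hR', hXR'⟩⟩ := hX
  obtain ⟨h, hh, hsel⟩ := hD.exists_selector hR hR'
  have hS : ∀ n, n ∈ X ↔ HasPath (R n) := hXR
  have hT : ∀ n, n ∉ X ↔ HasPath (R' n) := hXR'
  refine hh.of_eq fun n => ?_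
  obtain ⟨h1, h2, h3⟩ := hsel n (by rw [← hS, ← hT]; exact em _)
  rw [← hS] at h1 h3
  rw [← hT] at h2 h3
  have hdom : (h n).Dom := by
    by_contra hc
    exact (h3 hc).2 (h3 hc).1
  refine Part.eq_some_iff.2 ?_
  have hmem := Part.get_mem hdom
  cases hb : (h n).get hdom <;> rw [hb] at hmem
  · simpa [h2 hmem] using hmem
  · simpa [h1 hmem] using hmem

end

/-! ### Degrees that are PA over another degree -/

section

theorem SetDegree.Mem.exists (d : SetDegree) : ∃ D, d.Mem D :=
  ⟨_, toAntisymmetrization_ofAntisymmetrization _ d⟩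

theorem SetDegree.Mem.turingLE {d : SetDegree} {D E : Set ℕ} (hD : d.Mem D) (hE : d.Mem E) :
    SetTuringLE D E :=
  (Quotient.exact (hD.trans hE.symm) : AntisymmRel SetTuringLE D E).1

theorem SetDegree.Computes.computableIn {α σ : Type} [Primcodable α] [Primcodable σ]
    {d : SetDegree} {g : α → σ} (hg : d.Computes g) {D : Set ℕ} (hD : d.Mem D) :
    ComputableIn {charFn D} g := by
  obtain ⟨E, hE, hg⟩ := hg
  refine RecursiveIn.subst hg fun O hO => ?_
  rw [Set.mem_singleton_iff.1 hO]
  exact hE.turingLE hD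

open Classical in
/-- A degree that is PA over `d` computes a total extension of every partial `d`-computable
function with values `true` and `false`. The finite approximations of the total extensions form a
tree: a string belongs to it if it agrees with all values found in fewer steps than its length. -/
theorem IsPAOver.exists_total_extension {b d : SetDegree} (hbd : IsPAOver b d) {B D : Set ℕ}
    (hB : b.Mem B) (hD : d.Mem D) {h : ℕ →. Bool} (hh : RecursiveIn {charFn D} h) :
    ∃ X : ℕ → Bool, ComputableIn {charFn B} X ∧ ∀ p, ∀ v ∈ h p, X p = v := by
  obtain ⟨e, he⟩ := exists_oracleFn_eq (hh.map (Primrec.encode.comp Primrec.snd).computableIn :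
    RecursiveIn {charFn D} fun p => (h p).map Encodable.encode)
  obtain ⟨a, ha, hae⟩ := exists_approximation D
  have hval : ∀ p v, v ∈ h p ↔ ∃ s, a (e, p) s = some (Encodable.encode v) := by
    intro p v
    rw [← hae, he]
    simp
  -- `z` codes an argument and a number of steps, both at most `z`.
  let good : List Bool → ℕ → Prop := fun σ z =>
    a (e, z.unpair.1) z.unpair.2 = none ∨
      a (e, z.unpair.1) z.unpair.2 = (σ[z.unpair.1]?).map Encodable.encode
  let T : Set (List Bool) := {σ | ∀ z < σ.length, good σ z}
  have hgood : ComputableIn₂ {charFn D} fun σ z => decide (good σ z) := by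
    have h1 : ComputableIn {charFn D} fun q : List Bool × ℕ =>
        a (e, q.2.unpair.1) q.2.unpair.2 :=
      ha.comp (((ComputableIn.const e).pair
        (Primrec.fst.comp (Primrec.unpair.comp Primrec.snd)).computableIn).pair
        (Primrec.snd.comp (Primrec.unpair.comp Primrec.snd)).computableIn)
    have h2 : Primrec fun q : List Bool × ℕ => (q.1[q.2.unpair.1]?).map Encodable.encode :=
      Primrec.option_map (Primrec.list_getElem?.comp Primrec.fst
        (Primrec.fst.comp (Primrec.unpair.comp Primrec.snd))) (Primrec.encode.comp Primrec.snd)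
    refine (Primrec.or.computableIn₂.comp
      ((Primrec.eq.decide.computableIn₂.comp (h1.pair (ComputableIn.const none))).pair
        (Primrec.eq.decide.computableIn₂.comp (h1.pair h2.computableIn)))).of_eq fun q => ?_
    simp [good]
  have hT : d.ComputesSet T :=
    ⟨D, hD, (computableIn_forall_lt Primrec.list_length.computableIn hgood).of_eq
      fun σ => by simp [T]⟩
  have hpre : ∀ σ τ : List Bool, σ <+: τ → τ ∈ T → σ ∈ T := by
    rintro σ τ ⟨ρ, rfl⟩ hτ z hz
    have hz' : z.unpair.1 < σ.length := (Nat.unpair_left_le z).trans_lt hz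
    have := hτ z (hz.trans_le (by simp))
    simpa only [good, List.getElem?_append_left hz'] using this
  have hinf : T.Infinite := by
    let g : ℕ → Bool := fun p => if hp : (h p).Dom then (h p).get hp else false
    have hg : ∀ p, ∀ v ∈ h p, g p = v := by
      intro p v hv
      simp only [g, dif_pos hv.1]
      exact Part.get_eq_of_mem hv _
    refine Set.infinite_of_injective_forall_mem
      (f := fun n : ℕ => List.ofFn fun m : Fin n => g m) (fun m n hmn => ?_) fun n z hz => ?_
    · simpa using congrArg List.length hmn
    · have hz' : z.unpair.1 < n := (Nat.unpair_left_le z).trans_lt (by simpa using hz)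
      cases hs : a (e, z.unpair.1) z.unpair.2 with
      | none => exact Or.inl hs
      | some w =>
        have hw : w ∈ oracleFn e D z.unpair.1 := (hae _ _ _).2 ⟨_, hs⟩
        rw [he] at hw
        obtain ⟨v, hv, rfl⟩ := (Part.mem_map_iff _).1 hw
        exact Or.inr (by simp [hs, hz', hg _ v hv])
  obtain ⟨X, hX, hXT⟩ := hbd T hpre hinf hT
  refine ⟨X, hX.computableIn hB, fun p v hv => ?_⟩
  obtain ⟨s, hs⟩ := (hval p v).1 hv
  have hp : p < Nat.pair p s + 1 := Nat.lt_succ_of_le (Nat.left_le_pair p s)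
  have := hXT (Nat.pair p s + 1) (Nat.pair p s) (by simp)
  have hget : (List.ofFn fun m : Fin (Nat.pair p s + 1) => X m)[p]? = some (X p) := by
    rw [List.getElem?_ofFn, dif_pos hp]
  exact (show v = X p by simpa [good, hs, hget, -List.ofFn_succ] using this).symm

theorem IsPAOver.turingLE {b d : SetDegree} (hbd : IsPAOver b d) {B D : Set ℕ} (hB : b.Mem B)
    (hD : d.Mem D) : SetTuringLE D B := by
  classical
  have h1 : ComputableIn {charFn D} fun n => decide (n ∈ D) := by
    refine ((Primrec.eq.decide.comp Primrec.id (Primrec.const 1)).computableIn.comp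
      computableIn_charFn).of_eq fun n => ?_
    by_cases hn : n ∈ D <;> simp [hn]
  obtain ⟨X, hX, hXD⟩ := hbd.exists_total_extension hB hD h1
  refine ((Primrec.encode.computableIn (α := Bool)).comp hX).of_eq fun n => ?_
  rw [hXD n _ (Part.mem_some _)]
  by_cases hn : n ∈ D <;> simp [hn]

end

/-! ### Finding a path through a tree -/

section

theorem seg_succ_last (f : ℕ → ℕ) (k : ℕ) : seg f (k + 1) = seg f k ++ [f k] := by
  simp only [seg, List.ofFn_succ_last]
  rfl

/-- The strings `ρ` such that `τ ++ ρ` is in `R` and `ρ` does not start outside `(k, m]`. -/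
def intervalTree (R : List ℕ → Prop) (τ : List ℕ) (k m : ℕ) (ρ : List ℕ) : Prop :=
  (ρ = [] ∨ k < ρ.headI ∧ ρ.headI ≤ m) ∧ R (τ ++ ρ)

/-- Some path through `R` extends `τ` by an entry in `[k, m]`. -/
def HasPathIn (R : List ℕ → Prop) (τ : List ℕ) (k m : ℕ) : Prop :=
  ∃ f : ℕ → ℕ, k ≤ f 0 ∧ f 0 ≤ m ∧ ∀ j, R (τ ++ seg f j)

theorem hasPath_append_of_hasPathIn {R : List ℕ → Prop} {τ : List ℕ} {k : ℕ}
    (h : HasPathIn R τ k k) : HasPath fun ρ => R (τ ++ [k] ++ ρ) := by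
  obtain ⟨f, h1, h2, hf⟩ := h
  refine ⟨fun n => f (n + 1), fun j => ?_⟩
  have := hf (j + 1)
  rw [seg_succ, le_antisymm h2 h1] at this
  simpa using this

theorem HasPathIn.left_or_right {R : List ℕ → Prop} {τ : List ℕ} {k m : ℕ}
    (h : HasPathIn R τ k m) :
    HasPath (fun ρ => R (τ ++ [k] ++ ρ)) ∨ HasPath (intervalTree R τ k m) := by
  obtain ⟨f, h1, h2, hf⟩ := h
  rcases h1.eq_or_lt with h1 | h1
  · exact Or.inl (hasPath_append_of_hasPathIn ⟨f, h1.le, h1.ge, hf⟩)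
  · refine Or.inr ⟨f, fun j => ⟨?_, hf j⟩⟩
    cases j with
    | zero => exact Or.inl rfl
    | succ j => exact Or.inr (by simpa [seg_succ] using ⟨h1, h2⟩)

theorem hasPathIn_succ_of_intervalTree {R : List ℕ → Prop} {τ : List ℕ} {k m : ℕ}
    (h : HasPath (intervalTree R τ k m)) : HasPathIn R τ (k + 1) m := by
  obtain ⟨f, hf⟩ := h
  have := (hf 1).1
  simp only [seg_succ, reduceCtorEq, false_or, List.headI_cons] at this
  exact ⟨f, this.1, this.2, fun j => (hf j).2⟩

variable {R : ℕ → List ℕ → Prop}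

theorem computablePred_append {α : Type*} [Primcodable α]
    (hR : ComputablePred fun q : ℕ × List ℕ => R q.1 q.2) {n : α → ℕ} {τ : α → List ℕ}
    (hn : Computable n) (hτ : Computable τ) :
    ComputablePred fun q : α × List ℕ => R (n q.1) (τ q.1 ++ q.2) :=
  hR.comp ((hn.comp Computable.fst).pair
    (Primrec.list_append.to_comp.comp (hτ.comp Computable.fst) Computable.snd))

theorem computablePred_intervalTree {α : Type*} [Primcodable α]
    (hR : ComputablePred fun q : ℕ × List ℕ => R q.1 q.2) {n k m : α → ℕ} {τ : α → List ℕ}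
    (hn : Computable n) (hτ : Computable τ) (hk : Primrec k) (hm : Primrec m) :
    ComputablePred fun q : α × List ℕ => intervalTree (R (n q.1)) (τ q.1) (k q.1) (m q.1) q.2 := by
  have hhead : Primrec fun q : α × List ℕ => q.2.headI := Primrec.list_headI.comp Primrec.snd
  have h1 : PrimrecPred fun q : α × List ℕ =>
      q.2 = [] ∨ k q.1 < q.2.headI ∧ q.2.headI ≤ m q.1 :=
    (Primrec.eq.comp Primrec.snd (Primrec.const [])).or
      ((Primrec.nat_lt.comp (hk.comp Primrec.fst) hhead).and
        (Primrec.nat_le.comp hhead (hm.comp Primrec.fst)))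
  exact h1.computablePred.and (computablePred_append hR hn hτ)

/-- With an oracle that separates disjoint pairs of `D`-enumerable sets, the selector of
`FindsDescending.exists_selector` becomes total. -/
theorem FindsDescending.exists_total_selector {D B : Set ℕ} (hD : FindsDescending D)
    (hext : ∀ h : ℕ →. Bool, RecursiveIn {charFn D} h →
      ∃ X : ℕ → Bool, ComputableIn {charFn B} X ∧ ∀ p, ∀ v ∈ h p, X p = v)
    {S T : ℕ → List ℕ → Prop}
    (hS : ComputablePred fun q : ℕ × List ℕ => S q.1 q.2)
    (hT : ComputablePred fun q : ℕ × List ℕ => T q.1 q.2) :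
    ∃ X : ℕ → Bool, ComputableIn {charFn B} X ∧ ∀ p, HasPath (S p) ∨ HasPath (T p) →
      (X p = true → HasPath (S p)) ∧ (X p = false → HasPath (T p)) := by
  obtain ⟨h, hh, hsel⟩ := hD.exists_selector hS hT
  obtain ⟨X, hX, hXh⟩ := hext h hh
  refine ⟨X, hX, fun p hp => ?_⟩
  obtain ⟨h1, h2, h3⟩ := hsel p hp
  by_cases hdom : (h p).Dom
  · have hmem := Part.get_mem hdom
    have hXp := hXh p _ hmem
    rw [← hXp] at hmem
    exact ⟨fun hb => h1 (hb ▸ hmem), fun hb => h2 (hb ▸ hmem)⟩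
  · exact ⟨fun _ => (h3 hdom).1, fun _ => (h3 hdom).2⟩

/-- One step of the search for a path through `R n`. The first entry of a descending sequence in
the Kleene–Brouwer order bounds the next entry of some path; among the finitely many
candidates a correct one is found by asking for each `k` in turn whether to continue with `k` or
with a larger entry. -/
theorem FindsDescending.exists_step {D B : Set ℕ} (hD : FindsDescending D)
    (hDB : SetTuringLE D B)
    (hext : ∀ h : ℕ →. Bool, RecursiveIn {charFn D} h →
      ∃ X : ℕ → Bool, ComputableIn {charFn B} X ∧ ∀ p, ∀ v ∈ h p, X p = v)
    (hR : ComputablePred fun q : ℕ × List ℕ => R q.1 q.2) :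
    ∃ step : ℕ × List ℕ →. ℕ, RecursiveIn {charFn B} step ∧
      ∀ n τ, HasPath (fun ρ => R n (τ ++ ρ)) →
        ∃ k, step (n, τ) = Part.some k ∧ HasPath fun ρ => R n (τ ++ [k] ++ ρ) := by
  -- The families of trees are indexed by nodes `(n, τ)`, and by candidates `((n, τ), k, m)`.
  obtain ⟨node, codeNode, hnode, hcodeNode, node_code⟩ : ∃ (g : ℕ → ℕ × List ℕ) (c : _ → ℕ),
      Primrec g ∧ Primrec c ∧ ∀ q, g (c q) = q :=
    ⟨_, _, Primrec.ofNat _, Primrec.encode, Denumerable.ofNat_encode⟩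
  obtain ⟨cand, codeCand, hcand, hcodeCand, cand_code⟩ :
      ∃ (g : ℕ → (ℕ × List ℕ) × ℕ × ℕ) (c : _ → ℕ),
        Primrec g ∧ Primrec c ∧ ∀ q, g (c q) = q :=
    ⟨_, _, Primrec.ofNat _, Primrec.encode, Denumerable.ofNat_encode⟩
  obtain ⟨δ, hδ, hδσ⟩ := hD (fun p ρ => R (node p).1 ((node p).2 ++ ρ))
    (computablePred_append hR (Primrec.fst.comp hnode).to_comp (Primrec.snd.comp hnode).to_comp)
  have hn : Primrec fun p => (cand p).1.1 := Primrec.fst.comp (Primrec.fst.comp hcand)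
  have hτ : Primrec fun p => (cand p).1.2 := Primrec.snd.comp (Primrec.fst.comp hcand)
  have hk : Primrec fun p => (cand p).2.1 := Primrec.fst.comp (Primrec.snd.comp hcand)
  have hm : Primrec fun p => (cand p).2.2 := Primrec.snd.comp (Primrec.snd.comp hcand)
  obtain ⟨X, hX, hXsel⟩ := hD.exists_total_selector hext
    (S := fun p ρ => R (cand p).1.1 ((cand p).1.2 ++ [(cand p).2.1] ++ ρ))
    (T := fun p ρ => intervalTree (R (cand p).1.1) (cand p).1.2 (cand p).2.1 (cand p).2.2 ρ)
    (computablePred_append hR hn.to_comp (Primrec.list_concat.comp hτ hk).to_comp)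
    (computablePred_intervalTree hR hn.to_comp hτ.to_comp hk hm)
  let found : (ℕ × List ℕ) × List ℕ → ℕ → Bool := fun q k =>
    decide (q.2.headI ≤ k) || X (codeCand (q.1, k, q.2.headI))
  have hfound : ComputableIn₂ {charFn B} found := by
    have hhead : Primrec fun r : ((ℕ × List ℕ) × List ℕ) × ℕ => r.1.2.headI :=
      Primrec.list_headI.comp (Primrec.snd.comp Primrec.fst)
    have h1 : ComputableIn {charFn B} fun r : ((ℕ × List ℕ) × List ℕ) × ℕ =>
        decide (r.1.2.headI ≤ r.2) :=
      Primrec.computableIn (Primrec.nat_le.decide.comp hhead Primrec.snd)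
    have h2 : Primrec fun r : ((ℕ × List ℕ) × List ℕ) × ℕ =>
        codeCand (r.1.1, r.2, r.1.2.headI) :=
      hcodeCand.comp ((Primrec.fst.comp Primrec.fst).pair (Primrec.snd.pair hhead))
    have h3 := ComputableIn.comp Primrec.or.computableIn₂ (h1.pair (hX.comp h2.computableIn))
    exact h3
  have hδB : RecursiveIn {charFn B} fun q : ℕ × List ℕ => δ (codeNode q) 1 := by
    have : RecursiveIn₂ {charFn B} δ := RecursiveIn.subst hδ fun O hO => by
      rw [Set.mem_singleton_iff.1 hO]
      exact hDB
    exact RecursiveIn.comp this (hcodeNode.computableIn.pair (ComputableIn.const 1))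
  refine ⟨fun q => (δ (codeNode q) 1).bind fun σ => Nat.rfind (found (q, σ) : ℕ →. Bool),
    hδB.bind (RecursiveIn.rfind hfound), fun n τ hp => ?_⟩
  obtain ⟨σ, hσ, hδn⟩ := hδσ (codeNode (n, τ)) (by simpa [node_code] using hp)
  simp only [node_code] at hσ
  obtain ⟨f, hf, hle, -⟩ := hσ.exists_path_head
  set m := (σ 1).headI with hm_def
  have hm0 : HasPathIn (R n) τ 0 m := by
    refine ⟨f, Nat.zero_le _, hle 1 m ?_, hf⟩
    have := (hσ.kb_succ 0).ne_nil
    cases h1 : σ 1 with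
    | nil => exact absurd h1 this
    | cons b ρ => simp [m, h1]
  obtain ⟨k, hk, -⟩ := Nat.rfind_min' (p := found ((n, τ), σ 1)) (m := m)
    (by simp [found, ← hm_def])
  have hsel : ∀ j, HasPathIn (R n) τ j m →
      (X (codeCand ((n, τ), j, m)) = true → HasPath fun ρ => R n (τ ++ [j] ++ ρ)) ∧
      (X (codeCand ((n, τ), j, m)) = false → HasPathIn (R n) τ (j + 1) m) := by
    intro j hj
    have := hXsel (codeCand ((n, τ), j, m))
    simp only [cand_code] at this
    exact ⟨(this hj.left_or_right).1, fun h =>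
      hasPathIn_succ_of_intervalTree ((this hj.left_or_right).2 h)⟩
  have hinv : ∀ j ≤ k, HasPathIn (R n) τ j m := by
    intro j
    induction j with
    | zero => exact fun _ => hm0
    | succ j ih =>
      intro hj
      have := Nat.rfind_min hk (m := j) (by omega)
      have hX0 : found ((n, τ), σ 1) j = false := (Part.mem_some_iff.1 this).symm
      simp only [found, Bool.or_eq_false_iff] at hX0
      exact (hsel j (ih (by omega))).2 hX0.2
  refine ⟨k, ?_, ?_⟩
  · change (δ (codeNode (n, τ)) 1).bind _ = _
    rw [hδn, Part.bind_some]
    exact Part.eq_some_iff.2 hk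
  · have hfoundk : found ((n, τ), σ 1) k = true := (Part.mem_some_iff.1 (Nat.rfind_spec hk)).symm
    simp only [found, Bool.or_eq_true, decide_eq_true_eq] at hfoundk
    rcases hfoundk with h | h
    · obtain ⟨g, h1, h2, hg⟩ := hinv k le_rfl
      exact hasPath_append_of_hasPathIn ⟨g, h1, h2.trans h, hg⟩
    · exact (hsel k (hinv k le_rfl)).1 h

/-- Paths through the members of a computable family of trees are found uniformly. -/
theorem FindsDescending.exists_path_finder {D B : Set ℕ} (hD : FindsDescending D)
    (hDB : SetTuringLE D B)
    (hext : ∀ h : ℕ →. Bool, RecursiveIn {charFn D} h →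
      ∃ X : ℕ → Bool, ComputableIn {charFn B} X ∧ ∀ p, ∀ v ∈ h p, X p = v)
    (hR : ComputablePred fun q : ℕ × List ℕ => R q.1 q.2) :
    ∃ ψ : ℕ → ℕ →. ℕ, RecursiveIn₂ {charFn B} ψ ∧
      ∀ n, HasPath (R n) → ∃ f : ℕ → ℕ, (∀ k, R n (seg f k)) ∧ ∀ x, ψ n x = Part.some (f x) := by
  obtain ⟨step, hstep, hspec⟩ := hD.exists_step hDB hext hR
  let iter : ℕ → ℕ →. List ℕ := fun n x =>
    Nat.rec (motive := fun _ => Part (List ℕ)) (Part.some [])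
      (fun _ IH => IH.bind fun τ => (step (n, τ)).map fun k => τ ++ [k]) x
  have hiter : RecursiveIn₂ {charFn B} iter := by
    refine RecursiveIn.nat_rec (f := fun q : ℕ × ℕ => q.2) (g := fun _ => Part.some [])
      (h := fun q yi => (step (q.1, yi.2)).map fun k => yi.2 ++ [k]) ComputableIn.snd
      (ComputableIn.const []) ?_
    refine RecursiveIn.map (RecursiveIn.comp hstep
      ((Primrec.fst.comp Primrec.fst).pair (Primrec.snd.comp Primrec.snd)).computableIn) ?_
    exact (Primrec.list_concat.comp (Primrec.snd.comp (Primrec.snd.comp Primrec.fst))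
      Primrec.snd).computableIn
  refine ⟨fun n x => (iter n (x + 1)).map fun τ => τ.getD x 0, ?_, fun n hn => ?_⟩
  · exact RecursiveIn.map (RecursiveIn.comp hiter
      (Primrec.fst.pair (Primrec.succ.comp Primrec.snd)).computableIn)
      ((Primrec.list_getD 0).comp Primrec.snd (Primrec.snd.comp Primrec.fst)).computableIn
  · have hex : ∀ x, ∃ τ, iter n x = Part.some τ ∧ τ.length = x ∧
        HasPath fun ρ => R n (τ ++ ρ) := by
      intro x
      induction x with
      | zero => exact ⟨[], rfl, rfl, by simpa using hn⟩
      | succ x ih =>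
        obtain ⟨τ, h1, h2, h3⟩ := ih
        obtain ⟨k, hk, hk'⟩ := hspec n τ h3
        refine ⟨τ ++ [k], ?_, by simp [h2], hk'⟩
        change (iter n x).bind _ = _
        rw [h1, Part.bind_some, hk, Part.map_some]
    choose τ hτ hlen hpath using hex
    have hseg : ∀ k, seg (fun x => (τ (x + 1)).getD x 0) k = τ k := by
      intro k
      induction k with
      | zero => exact (List.eq_nil_of_length_eq_zero (hlen 0)).symm
      | succ x ih =>
        obtain ⟨k, hk, -⟩ := hspec n (τ x) (hpath x)
        have : iter n (x + 1) = Part.some (τ x ++ [k]) := by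
          change (iter n x).bind _ = _
          rw [hτ x, Part.bind_some, hk, Part.map_some]
        have h' : τ (x + 1) = τ x ++ [k] := Part.some_injective ((hτ (x + 1)).symm.trans this)
        rw [seg_succ_last, ih, h']
        congr 2
        rw [List.getD_eq_getElem?_getD, List.getElem?_append_right (hlen x).le, hlen x]
        simp
    refine ⟨fun x => (τ (x + 1)).getD x 0, fun k => ?_, fun x => ?_⟩
    · rw [hseg]
      obtain ⟨g, hg⟩ := hpath k
      simpa using hg 0
    · exact (congrArg (Part.map _) (hτ (x + 1))).trans (Part.map_some _ _)

end

/-! ### Isomorphisms as paths -/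

section

/-- The result of `φ_i` on `x` within `t` steps, if there is one. -/
def stepEval (i t x : ℕ) : Option ℕ := (Denumerable.ofNat Nat.Partrec.Code i).evaln t x

theorem mem_partFn_of_stepEval {i t x v : ℕ} (h : stepEval i t x = some v) : v ∈ partFn i x :=
  Nat.Partrec.Code.evaln_sound h

theorem eventually_stepEval {i x v : ℕ} (h : v ∈ partFn i x) :
    ∀ᶠ t in Filter.atTop, stepEval i t x = some v := by
  obtain ⟨k, hk⟩ := Nat.Partrec.Code.evaln_complete.1 h
  exact Filter.eventually_atTop.2 ⟨k, fun t ht => Nat.Partrec.Code.evaln_mono ht hk⟩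

theorem primrec_stepEval {α : Type*} [Primcodable α] {i t x : α → ℕ} (hi : Primrec i)
    (ht : Primrec t) (hx : Primrec x) : Primrec fun a => stepEval (i a) (t a) (x a) :=
  Nat.Partrec.Code.primrec_evaln.comp ((ht.pair ((Primrec.ofNat _).comp hi)).pair hx)

/-- The number `f x` codes the values at `x` of an isomorphism (first component) and of its inverse
(second component), with arbitrary values outside the domains. -/
structure IsIsoCode (i j : ℕ) (f : ℕ → ℕ) : Prop where
  fwd_mem : ∀ x, 1 ∈ partFn i (Nat.pair 1 x) → 0 ∉ partFn j (Nat.pair 1 (f x).unpair.1)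
  bwd_fwd : ∀ x, 1 ∈ partFn i (Nat.pair 1 x) → (f (f x).unpair.1).unpair.2 = x
  bwd_mem : ∀ x, 1 ∈ partFn j (Nat.pair 1 x) → 0 ∉ partFn i (Nat.pair 1 (f x).unpair.2)
  fwd_bwd : ∀ x, 1 ∈ partFn j (Nat.pair 1 x) → (f (f x).unpair.2).unpair.1 = x
  map_fun : ∀ (k : ℕ) (L : List ℕ) (v v' : ℕ),
    Encodable.encode (some (Sum.inl L.length) : Option (ℕ ⊕ ℕ)) ∈ partFn i (Nat.pair 0 k) →
    (∀ x ∈ L, 1 ∈ partFn i (Nat.pair 1 x)) →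
    v ∈ partFn i (Nat.pair (k + 2) (Encodable.encode L)) →
    v' ∈ partFn j (Nat.pair (k + 2) (Encodable.encode (L.map fun x => (f x).unpair.1))) →
    v' = (f v).unpair.1
  map_rel : ∀ (k : ℕ) (L : List ℕ) (v v' : ℕ),
    Encodable.encode (some (Sum.inr L.length) : Option (ℕ ⊕ ℕ)) ∈ partFn i (Nat.pair 0 k) →
    (∀ x ∈ L, 1 ∈ partFn i (Nat.pair 1 x)) →
    v ∈ partFn i (Nat.pair (k + 2) (Encodable.encode L)) →
    v' ∈ partFn j (Nat.pair (k + 2) (Encodable.encode (L.map fun x => (f x).unpair.1))) →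
    v' = v

/-- The value at `x` of the map coded by the string `σ`. -/
def fwdVal (σ : List ℕ) (x : ℕ) : ℕ := (σ.getD x 0).unpair.1

/-- The value at `x` of the inverse map coded by the string `σ`. -/
def bwdVal (σ : List ℕ) (x : ℕ) : ℕ := (σ.getD x 0).unpair.2

theorem fwdVal_seg {f : ℕ → ℕ} {s x : ℕ} (h : x < s) : fwdVal (seg f s) x = (f x).unpair.1 := by
  rw [fwdVal, List.getD_eq_getElem?_getD, getElem?_seg f h]
  rfl

theorem bwdVal_seg {f : ℕ → ℕ} {s x : ℕ} (h : x < s) : bwdVal (seg f s) x = (f x).unpair.2 := by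
  rw [bwdVal, List.getD_eq_getElem?_getD, getElem?_seg f h]
  rfl

theorem primrec_fwdVal : Primrec₂ fwdVal :=
  Primrec.fst.comp (Primrec.unpair.comp (Primrec.list_getD 0))

theorem primrec_bwdVal : Primrec₂ bwdVal :=
  Primrec.snd.comp (Primrec.unpair.comp (Primrec.list_getD 0))

/-- Within `s` steps, `x` is seen to be in the domain of the `i`-th structure, and its image `y` is
seen to be outside the domain of the `j`-th one, or `y` has the wrong preimage `z`. -/
def DomainConflict (i j s x y z : ℕ) : Prop :=
  stepEval i s (Nat.pair 1 x) = some 1 ∧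
    (stepEval j s (Nat.pair 1 y) = some 0 ∨ y < s ∧ z ≠ x)

/-- The entries of `L` are below `s`, and are seen to be in the domain of the `i`-th structure
within `s` steps. -/
def ArgsSeen (i s : ℕ) (L : List ℕ) : Prop :=
  ∀ x ∈ L, x < s ∧ stepEval i s (Nat.pair 1 x) = some 1

/-- Within `|σ|` steps, the map coded by `σ` is seen not to respect the function with number `k` at
the arguments `L`. -/
def FunConflict (i j : ℕ) (σ : List ℕ) (k : ℕ) (L : List ℕ) : Prop :=
  stepEval i σ.length (Nat.pair 0 k) =
      some (Encodable.encode (some (Sum.inl L.length) : Option (ℕ ⊕ ℕ))) ∧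
    ArgsSeen i σ.length L ∧
    ∃ v < σ.length, stepEval i σ.length (Nat.pair (k + 2) (Encodable.encode L)) = some v ∧
      stepEval j σ.length (Nat.pair (k + 2) (Encodable.encode (L.map (fwdVal σ)))) ≠ none ∧
      stepEval j σ.length (Nat.pair (k + 2) (Encodable.encode (L.map (fwdVal σ)))) ≠
        some (fwdVal σ v)

/-- Within `|σ|` steps, the map coded by `σ` is seen not to respect the relation with number `k` at
the arguments `L`. -/
def RelConflict (i j : ℕ) (σ : List ℕ) (k : ℕ) (L : List ℕ) : Prop :=
  stepEval i σ.length (Nat.pair 0 k) =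
      some (Encodable.encode (some (Sum.inr L.length) : Option (ℕ ⊕ ℕ))) ∧
    ArgsSeen i σ.length L ∧
    stepEval i σ.length (Nat.pair (k + 2) (Encodable.encode L)) ≠ none ∧
      stepEval j σ.length (Nat.pair (k + 2) (Encodable.encode (L.map (fwdVal σ)))) ≠ none ∧
      stepEval j σ.length (Nat.pair (k + 2) (Encodable.encode (L.map (fwdVal σ)))) ≠
        stepEval i σ.length (Nat.pair (k + 2) (Encodable.encode L))

/-- The number `w`, read as an element or as a symbol with a tuple of arguments, witnesses that the
string `σ` does not code part of an isomorphism. -/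
def Conflict (i j : ℕ) (σ : List ℕ) (w : ℕ) : Prop :=
  DomainConflict i j σ.length w (fwdVal σ w) (bwdVal σ (fwdVal σ w)) ∨
  DomainConflict j i σ.length w (bwdVal σ w) (fwdVal σ (bwdVal σ w)) ∨
  FunConflict i j σ (Denumerable.ofNat (ℕ × List ℕ) w).1 (Denumerable.ofNat (ℕ × List ℕ) w).2 ∨
  RelConflict i j σ (Denumerable.ofNat (ℕ × List ℕ) w).1 (Denumerable.ofNat (ℕ × List ℕ) w).2

/-- The tree of partial isomorphisms between the structures with indices `p.unpair.1` and
`p.unpair.2`. -/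
def isoTree (p : ℕ) (σ : List ℕ) : Prop :=
  ∀ w < σ.length, ¬ Conflict p.unpair.1 p.unpair.2 σ w

section

variable {α : Type*} [Primcodable α] {i j s k x y z : α → ℕ} {σ L : α → List ℕ}

theorem primrec_encodePair (hk : Primrec k) (hL : Primrec L) :
    Primrec fun a => Nat.pair (k a + 2) (Encodable.encode (L a)) :=
  Primrec₂.natPair.comp (Primrec.nat_add.comp hk (Primrec.const 2)) (Primrec.encode.comp hL)

theorem primrecPred_domainConflict (hi : Primrec i) (hj : Primrec j) (hs : Primrec s)
    (hx : Primrec x) (hy : Primrec y) (hz : Primrec z) :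
    PrimrecPred fun a => DomainConflict (i a) (j a) (s a) (x a) (y a) (z a) :=
  (Primrec.eq.comp (primrec_stepEval hi hs (Primrec₂.natPair.comp (Primrec.const 1) hx))
    (Primrec.const (some 1))).and <|
  (Primrec.eq.comp (primrec_stepEval hj hs (Primrec₂.natPair.comp (Primrec.const 1) hy))
    (Primrec.const (some 0))).or <|
  (Primrec.nat_lt.comp hy hs).and (Primrec.eq.comp hz hx).not

theorem primrecPred_argsSeen (hi : Primrec i) (hs : Primrec s) (hL : Primrec L) :
    PrimrecPred fun a => ArgsSeen (i a) (s a) (L a) := by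
  have h : PrimrecRel fun (x : ℕ) (q : ℕ × ℕ) =>
      x < q.2 ∧ stepEval q.1 q.2 (Nat.pair 1 x) = some 1 :=
    (Primrec.nat_lt.comp Primrec.fst (Primrec.snd.comp Primrec.snd)).and
      (Primrec.eq.comp (primrec_stepEval (Primrec.fst.comp Primrec.snd)
        (Primrec.snd.comp Primrec.snd) (Primrec₂.natPair.comp (Primrec.const 1) Primrec.fst))
        (Primrec.const (some 1)))
  exact h.forall_mem_list.comp hL (hi.pair hs)

theorem primrec_map_fwdVal (hσ : Primrec σ) (hL : Primrec L) :
    Primrec fun a => (L a).map (fwdVal (σ a)) :=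
  Primrec.list_map hL (primrec_fwdVal.comp (hσ.comp Primrec.fst) Primrec.snd)

theorem primrecPred_funConflict (hi : Primrec i) (hj : Primrec j) (hσ : Primrec σ)
    (hk : Primrec k) (hL : Primrec L) :
    PrimrecPred fun a => FunConflict (i a) (j a) (σ a) (k a) (L a) := by
  have hs := Primrec.list_length.comp hσ
  have hu := primrec_stepEval hi hs (primrec_encodePair hk hL)
  have hu' := primrec_stepEval hj hs (primrec_encodePair hk (primrec_map_fwdVal hσ hL))
  have hv : PrimrecRel fun (v : ℕ) (a : α) =>
      stepEval (i a) (σ a).length (Nat.pair (k a + 2) (Encodable.encode (L a))) = some v ∧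
      stepEval (j a) (σ a).length
        (Nat.pair (k a + 2) (Encodable.encode ((L a).map (fwdVal (σ a))))) ≠ none ∧
      stepEval (j a) (σ a).length
        (Nat.pair (k a + 2) (Encodable.encode ((L a).map (fwdVal (σ a))))) ≠
          some (fwdVal (σ a) v) :=
    (Primrec.eq.comp (hu.comp Primrec.snd) (Primrec.option_some.comp Primrec.fst)).and <|
    (Primrec.eq.comp (hu'.comp Primrec.snd) (Primrec.const none)).not.and
    (Primrec.eq.comp (hu'.comp Primrec.snd) (Primrec.option_some.comp
      (primrec_fwdVal.comp (hσ.comp Primrec.snd) Primrec.fst))).not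
  have harity : Primrec fun a =>
      some (Encodable.encode (some (Sum.inl (L a).length) : Option (ℕ ⊕ ℕ))) :=
    Primrec.option_some.comp (Primrec.encode.comp (Primrec.option_some.comp
      (Primrec.sumInl.comp (Primrec.list_length.comp hL))))
  exact (Primrec.eq.comp (primrec_stepEval hi hs (Primrec₂.natPair.comp (Primrec.const 0) hk))
    harity).and ((primrecPred_argsSeen hi hs hL).and (hv.exists_lt_left.comp hs Primrec.id))

theorem primrecPred_relConflict (hi : Primrec i) (hj : Primrec j) (hσ : Primrec σ)
    (hk : Primrec k) (hL : Primrec L) :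
    PrimrecPred fun a => RelConflict (i a) (j a) (σ a) (k a) (L a) := by
  have hs := Primrec.list_length.comp hσ
  have hu := primrec_stepEval hi hs (primrec_encodePair hk hL)
  have hu' := primrec_stepEval hj hs (primrec_encodePair hk (primrec_map_fwdVal hσ hL))
  have harity : Primrec fun a =>
      some (Encodable.encode (some (Sum.inr (L a).length) : Option (ℕ ⊕ ℕ))) :=
    Primrec.option_some.comp (Primrec.encode.comp (Primrec.option_some.comp
      (Primrec.sumInr.comp (Primrec.list_length.comp hL))))
  exact (Primrec.eq.comp (primrec_stepEval hi hs (Primrec₂.natPair.comp (Primrec.const 0) hk))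
    harity).and <| (primrecPred_argsSeen hi hs hL).and <|
    (Primrec.eq.comp hu (Primrec.const none)).not.and <|
    (Primrec.eq.comp hu' (Primrec.const none)).not.and (Primrec.eq.comp hu' hu).not

theorem primrecPred_conflict (hi : Primrec i) (hj : Primrec j) (hσ : Primrec σ)
    (hx : Primrec x) : PrimrecPred fun a => Conflict (i a) (j a) (σ a) (x a) := by
  have hs := Primrec.list_length.comp hσ
  have hw : Primrec fun a => Denumerable.ofNat (ℕ × List ℕ) (x a) := (Primrec.ofNat _).comp hx
  have hf := primrec_fwdVal.comp hσ hx
  have hb := primrec_bwdVal.comp hσ hx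
  exact (primrecPred_domainConflict hi hj hs hx hf (primrec_bwdVal.comp hσ hf)).or <|
    (primrecPred_domainConflict hj hi hs hx hb (primrec_fwdVal.comp hσ hb)).or <|
    (primrecPred_funConflict hi hj hσ (Primrec.fst.comp hw) (Primrec.snd.comp hw)).or
    (primrecPred_relConflict hi hj hσ (Primrec.fst.comp hw) (Primrec.snd.comp hw))

end

theorem computablePred_isoTree : ComputablePred fun q : ℕ × List ℕ => isoTree q.1 q.2 := by
  have hp : Primrec fun q : ℕ × ℕ × List ℕ => q.2.1.unpair :=
    Primrec.unpair.comp (Primrec.fst.comp Primrec.snd)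
  have h : PrimrecRel fun (w : ℕ) (q : ℕ × List ℕ) =>
      ¬ Conflict q.1.unpair.1 q.1.unpair.2 q.2 w :=
    (primrecPred_conflict (Primrec.fst.comp hp) (Primrec.snd.comp hp)
      (Primrec.snd.comp Primrec.snd) Primrec.fst).not
  exact (h.forall_lt_left.comp (Primrec.list_length.comp Primrec.snd) Primrec.id).computablePred

theorem ArgsSeen.map_fwdVal {i s : ℕ} {L : List ℕ} (h : ArgsSeen i s L) (f : ℕ → ℕ) :
    L.map (fwdVal (seg f s)) = L.map fun x => (f x).unpair.1 :=
  List.map_congr_left fun x hx => fwdVal_seg (h x hx).1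

/-- No path through the tree of partial isomorphisms is lost. -/
theorem IsIsoCode.isoTree_seg {i j : ℕ} {f : ℕ → ℕ} (h : IsIsoCode i j f) (s : ℕ) :
    isoTree (Nat.pair i j) (seg f s) := by
  intro w hw hc
  simp only [Conflict, Nat.unpair_pair, length_seg] at hw hc
  rw [fwdVal_seg hw, bwdVal_seg hw] at hc
  rcases hc with ⟨h1, h2 | ⟨h2, h3⟩⟩ | ⟨h1, h2 | ⟨h2, h3⟩⟩ | hc | hc
  · exact h.fwd_mem w (mem_partFn_of_stepEval h1) (mem_partFn_of_stepEval h2)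
  · rw [bwdVal_seg h2] at h3
    exact h3 (h.bwd_fwd w (mem_partFn_of_stepEval h1))
  · exact h.bwd_mem w (mem_partFn_of_stepEval h1) (mem_partFn_of_stepEval h2)
  · rw [fwdVal_seg h2] at h3
    exact h3 (h.fwd_bwd w (mem_partFn_of_stepEval h1))
  · obtain ⟨h1, h2, v, hv, h3, h4, h5⟩ := hc
    simp only [length_seg] at h1 h2 hv h3 h4 h5
    rw [h2.map_fwdVal] at h4 h5
    obtain ⟨v', hv'⟩ := Option.ne_none_iff_exists'.1 h4
    rw [hv', fwdVal_seg hv] at h5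
    exact h5 (congrArg some (h.map_fun _ _ v v' (mem_partFn_of_stepEval h1)
      (fun x hx => mem_partFn_of_stepEval (h2 x hx).2) (mem_partFn_of_stepEval h3)
      (mem_partFn_of_stepEval hv')))
  · obtain ⟨h1, h2, h3, h4, h5⟩ := hc
    simp only [length_seg] at h1 h2 h3 h4 h5
    rw [h2.map_fwdVal] at h4 h5
    obtain ⟨v, hv⟩ := Option.ne_none_iff_exists'.1 h3
    obtain ⟨v', hv'⟩ := Option.ne_none_iff_exists'.1 h4
    rw [hv, hv'] at h5
    exact h5 (congrArg some (h.map_rel _ _ v v' (mem_partFn_of_stepEval h1)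
      (fun x hx => mem_partFn_of_stepEval (h2 x hx).2) (mem_partFn_of_stepEval hv)
      (mem_partFn_of_stepEval hv')))

theorem eventually_argsSeen {i : ℕ} {L : List ℕ} (h : ∀ x ∈ L, 1 ∈ partFn i (Nat.pair 1 x)) :
    ∀ᶠ s in Filter.atTop, ArgsSeen i s L := by
  induction L with
  | nil => exact Filter.Eventually.of_forall fun s x hx => absurd hx List.not_mem_nil
  | cons a L ih =>
    filter_upwards [ih fun x hx => h x (List.mem_cons_of_mem _ hx),
      eventually_stepEval (h a List.mem_cons_self), Filter.eventually_gt_atTop a] with s h1 h2 h3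
    intro x hx
    rcases List.mem_cons.1 hx with rfl | hx
    exacts [⟨h3, h2⟩, h1 x hx]

/-- Every failure to be an isomorphism is seen at some finite stage. -/
theorem isIsoCode_of_isoTree {i j : ℕ} {f : ℕ → ℕ} (h : ∀ s, isoTree (Nat.pair i j) (seg f s)) :
    IsIsoCode i j f := by
  have hno : ∀ w, ¬ ∀ᶠ s in Filter.atTop, Conflict i j (seg f s) w := by
    intro w hc
    obtain ⟨s, hs, hw⟩ := (hc.and (Filter.eventually_gt_atTop w)).exists
    have := h s w (by simpa using hw)
    simp only [Nat.unpair_pair] at this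
    exact this hs
  refine ⟨fun x hx h0 => hno x ?_, fun x hx => by_contra fun hne => hno x ?_,
    fun x hx h0 => hno x ?_, fun x hx => by_contra fun hne => hno x ?_,
    fun k L v v' h1 h2 h3 h4 => by_contra fun hne => hno (Encodable.encode (k, L)) ?_,
    fun k L v v' h1 h2 h3 h4 => by_contra fun hne => hno (Encodable.encode (k, L)) ?_⟩
  · filter_upwards [eventually_stepEval hx, eventually_stepEval h0,
      Filter.eventually_gt_atTop x] with s h1 h2 h3
    refine Or.inl ?_
    rw [fwdVal_seg h3, length_seg]
    exact ⟨h1, Or.inl h2⟩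
  · filter_upwards [eventually_stepEval hx, Filter.eventually_gt_atTop x,
      Filter.eventually_gt_atTop (f x).unpair.1] with s h1 h2 h3
    refine Or.inl ?_
    rw [fwdVal_seg h2, bwdVal_seg h3, length_seg]
    exact ⟨h1, Or.inr ⟨h3, hne⟩⟩
  · filter_upwards [eventually_stepEval hx, eventually_stepEval h0,
      Filter.eventually_gt_atTop x] with s h1 h2 h3
    refine Or.inr (Or.inl ?_)
    rw [bwdVal_seg h3, length_seg]
    exact ⟨h1, Or.inl h2⟩
  · filter_upwards [eventually_stepEval hx, Filter.eventually_gt_atTop x,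
      Filter.eventually_gt_atTop (f x).unpair.2] with s h1 h2 h3
    refine Or.inr (Or.inl ?_)
    rw [bwdVal_seg h2, fwdVal_seg h3, length_seg]
    exact ⟨h1, Or.inr ⟨h3, hne⟩⟩
  · filter_upwards [eventually_stepEval h1, eventually_argsSeen h2, eventually_stepEval h3,
      eventually_stepEval h4, Filter.eventually_gt_atTop v] with s g1 g2 g3 g4 g5
    refine Or.inr (Or.inr (Or.inl ?_))
    simp only [Denumerable.ofNat_encode, FunConflict, length_seg, g2.map_fwdVal]
    exact ⟨g1, g2, v, g5, g3, by simp [g4], by simpa [g4, fwdVal_seg g5] using hne⟩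
  · filter_upwards [eventually_stepEval h1, eventually_argsSeen h2, eventually_stepEval h3,
      eventually_stepEval h4] with s g1 g2 g3 g4
    refine Or.inr (Or.inr (Or.inr ?_))
    simp only [Denumerable.ofNat_encode, RelConflict, length_seg, g2.map_fwdVal]
    exact ⟨g1, g2, by simp [g3], by simp [g4], by simpa [g3, g4] using hne⟩

end

section

open FirstOrder

variable {s : ℕ → Option (ℕ ⊕ ℕ)} {A B : Set ℕ} [(codedLanguage s).Structure A]
  [(codedLanguage s).Structure B] {i j : ℕ}

theorem IsStructureIndex.mem_iff (h : IsStructureIndex i s A) {x : ℕ} :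
    x ∈ A ↔ 1 ∈ partFn i (Nat.pair 1 x) := by
  have := h.2.1 x
  by_cases hx : x ∈ A
  · simpa [hx] using this
  · simp only [hx, if_false] at this
    exact ⟨fun h => absurd h hx, fun h1 => absurd (Part.mem_unique h1 this) one_ne_zero⟩

theorem IsStructureIndex.mem_of_zero_notMem (h : IsStructureIndex i s A) {x : ℕ}
    (h0 : 0 ∉ partFn i (Nat.pair 1 x)) : x ∈ A := by
  by_contra hx
  have := h.2.1 x
  simp only [hx, if_false] at this
  exact h0 this

theorem IsStructureIndex.symbol_eq (h : IsStructureIndex i s A) {k : ℕ} {o : Option (ℕ ⊕ ℕ)}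
    (ho : Encodable.encode o ∈ partFn i (Nat.pair 0 k)) : s k = o :=
  Encodable.encode_injective (Part.mem_unique (h.1 k) ho)

/-- A path through the tree of partial isomorphisms is an isomorphism. -/
theorem IsIsoCode.exists_equiv (hi : IsStructureIndex i s A) (hj : IsStructureIndex j s B)
    {f : ℕ → ℕ} (h : IsIsoCode i j f) :
    ∃ g : (codedLanguage s).Equiv A B, ∀ x : A, (g x : ℕ) = (f x).unpair.1 := by
  have hmap : ∀ {n : ℕ} (a : Fin n → A), (∀ x ∈ List.ofFn fun m => (a m : ℕ),
      1 ∈ partFn i (Nat.pair 1 x)) := by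
    intro n a x hx
    obtain ⟨m, rfl⟩ := (List.mem_ofFn' _ _).1 hx
    exact hi.mem_iff.1 (a m).2
  let e : A ≃ B :=
    { toFun := fun x => ⟨(f x).unpair.1, hj.mem_of_zero_notMem (h.fwd_mem x (hi.mem_iff.1 x.2))⟩
      invFun := fun y => ⟨(f y).unpair.2, hi.mem_of_zero_notMem (h.bwd_mem y (hj.mem_iff.1 y.2))⟩
      left_inv := fun x => Subtype.ext (h.bwd_fwd x (hi.mem_iff.1 x.2))
      right_inv := fun y => Subtype.ext (h.fwd_bwd y (hj.mem_iff.1 y.2)) }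
  have hlist : ∀ {n : ℕ} (a : Fin n → A), (List.ofFn fun m => (a m : ℕ)).map
      (fun x => (f x).unpair.1) = List.ofFn fun m => (((e ∘ a) m : B) : ℕ) := by
    intro n a
    rw [List.map_ofFn]
    rfl
  refine ⟨⟨e, fun {n} F a => ?_, fun {n} r a => ?_⟩, fun x => rfl⟩
  · refine Subtype.ext (h.map_fun F.1 (List.ofFn fun m => (a m : ℕ)) _ _ ?_ (hmap a)
      (hi.2.2.1 n F a) ?_).symm
    · have := hi.1 F.1
      rw [F.2] at this
      simpa using this
    · rw [hlist]
      exact hj.2.2.1 n F (e ∘ a)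
  · have := h.map_rel r.1 (List.ofFn fun m => (a m : ℕ)) _ _ ?_ (hmap a)
      (hi.2.2.2 n r a) (by rw [hlist]; exact hj.2.2.2 n r (e ∘ a))
    · by_cases h1 : Language.Structure.RelMap r a <;>
        by_cases h2 : Language.Structure.RelMap r (e ∘ a) <;> simp_all
    · have := hi.1 r.1
      rw [r.2] at this
      simpa using this

open Classical in
/-- An isomorphism is a path through the tree of partial isomorphisms. -/
theorem exists_isIsoCode (hi : IsStructureIndex i s A) (hj : IsStructureIndex j s B)
    (g : (codedLanguage s).Equiv A B) : ∃ f, IsIsoCode i j f := by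
  let f : ℕ → ℕ := fun x => Nat.pair (if hx : x ∈ A then (g ⟨x, hx⟩ : ℕ) else 0)
    (if hx : x ∈ B then (g.symm ⟨x, hx⟩ : ℕ) else 0)
  have hf1 : ∀ x : A, (f x).unpair.1 = g x := fun x => by simp [f]
  have hf2 : ∀ y : B, (f y).unpair.2 = g.symm y := fun y => by simp [f]
  have hA : ∀ {x}, 1 ∈ partFn i (Nat.pair 1 x) → ∃ a : A, (a : ℕ) = x :=
    fun hx => ⟨⟨_, hi.mem_iff.2 hx⟩, rfl⟩
  have hB : ∀ {x}, 1 ∈ partFn j (Nat.pair 1 x) → ∃ a : B, (a : ℕ) = x :=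
    fun hx => ⟨⟨_, hj.mem_iff.2 hx⟩, rfl⟩
  have hargs : ∀ {L : List ℕ}, (∀ x ∈ L, 1 ∈ partFn i (Nat.pair 1 x)) →
      ∃ a : Fin L.length → A, (L = List.ofFn fun m => (a m : ℕ)) ∧
        (L.map fun x => (f x).unpair.1) = List.ofFn fun m => ((g ∘ a) m : ℕ) := by
    intro L hL
    have hL' : L = List.ofFn fun m : Fin L.length => L.get m := (List.ofFn_get L).symm
    refine ⟨fun m => ⟨L.get m, hi.mem_iff.2 (hL _ (List.get_mem L m))⟩, hL', ?_⟩
    conv_lhs => rw [hL', List.map_ofFn]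
    congr 1
    funext m
    exact hf1 ⟨L.get m, _⟩
  refine ⟨f, fun x hx h0 => ?_, fun x hx => ?_, fun x hx h0 => ?_, fun x hx => ?_,
    fun k L v v' h1 h2 h3 h4 => ?_, fun k L v v' h1 h2 h3 h4 => ?_⟩
  · obtain ⟨a, rfl⟩ := hA hx
    rw [hf1] at h0
    exact absurd (Part.mem_unique h0 (hj.mem_iff.1 (g a).2)) zero_ne_one
  · obtain ⟨a, rfl⟩ := hA hx
    rw [hf1, hf2, Language.Equiv.symm_apply_apply]
  · obtain ⟨a, rfl⟩ := hB hx
    rw [hf2] at h0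
    exact absurd (Part.mem_unique h0 (hi.mem_iff.1 (g.symm a).2)) zero_ne_one
  · obtain ⟨a, rfl⟩ := hB hx
    rw [hf2, hf1, Language.Equiv.apply_symm_apply]
  · obtain ⟨a, ha, hga⟩ := hargs h2
    let F : (codedLanguage s).Functions L.length := ⟨k, hi.symbol_eq h1⟩
    have e1 := hi.2.2.1 _ F a
    have e2 := hj.2.2.1 _ F (g ∘ a)
    rw [← ha] at e1
    rw [← hga] at e2
    rw [Part.mem_unique h3 e1, Part.mem_unique h4 e2, hf1]
    exact congrArg Subtype.val (g.map_fun F a).symm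
  · obtain ⟨a, ha, hga⟩ := hargs h2
    let r : (codedLanguage s).Relations L.length := ⟨k, hi.symbol_eq h1⟩
    have e1 := hi.2.2.2 _ r a
    have e2 := hj.2.2.2 _ r (g ∘ a)
    rw [← ha] at e1
    rw [← hga] at e2
    rw [Part.mem_unique h3 e1, Part.mem_unique h4 e2]
    exact if_congr (g.map_rel r a) rfl rfl

end

/-! ### Uniform computation of isomorphisms -/

/-- A partial computable function that halts on `(i, x)` exactly if `φ_i` says that `x` is in the
domain. It makes the computed isomorphism diverge outside its domain. -/
theorem exists_partrec_guard : ∃ G : ℕ × ℕ →. ℕ, Partrec G ∧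
    ∀ i x v, v ∈ G (i, x) ↔ v = 0 ∧ 1 ∈ partFn i (Nat.pair 1 x) := by
  have hP : Partrec fun q : ℕ × ℕ => partFn q.1 (Nat.pair 1 q.2) :=
    Nat.Partrec.Code.eval_part.comp ((Primrec.ofNat Nat.Partrec.Code).comp Primrec.fst).to_comp
      (Primrec₂.natPair.comp (Primrec.const 1) Primrec.snd).to_comp
  have hC : Partrec₂ fun (_ : ℕ × ℕ) (v : ℕ) => bif v == 1 then Part.some 0 else Part.none :=
    Partrec.cond (Primrec.beq.comp Primrec.snd (Primrec.const 1)).to_comp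
      (Computable.const 0).partrec Partrec.none
  refine ⟨_, hP.bind hC, fun i x v => ?_⟩
  simp only [Part.mem_bind_iff]
  constructor
  · rintro ⟨u, hu, hv⟩
    by_cases h1 : u = 1
    · subst h1
      exact ⟨by simpa using hv, hu⟩
    · rw [show (u == 1) = false by simpa using h1] at hv
      exact absurd hv (Part.notMem_none v)
  · rintro ⟨rfl, hx⟩
    exact ⟨1, hx, by simp⟩

theorem uniformlyHighForIsomorphism_of_isPAOver {d b : SetDegree}
    (hd : UniformlyHighForDescendingSequences d) (hbd : IsPAOver b d) :
    UniformlyHighForIsomorphism b := by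
  obtain ⟨D, hD, hfind⟩ := hd.exists_findsDescending
  obtain ⟨B, hB⟩ := SetDegree.Mem.exists b
  obtain ⟨ψ, hψ, hpath⟩ := hfind.exists_path_finder (hbd.turingLE hB hD)
    (fun h hh => hbd.exists_total_extension hB hD hh) computablePred_isoTree
  obtain ⟨G, hG, hGmem⟩ := exists_partrec_guard
  have hθ : RecursiveIn₂ {charFn B} fun n x : ℕ =>
      (G (n.unpair.1, x)).bind fun _ => (ψ n x).map fun y => y.unpair.1 := by
    have h1 : RecursiveIn {charFn B} fun q : ℕ × ℕ => G (q.1.unpair.1, q.2) :=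
      RecursiveIn.comp hG.recursiveIn
        ((Primrec.fst.comp (Primrec.unpair.comp Primrec.fst)).pair Primrec.snd).computableIn
    refine h1.bind (RecursiveIn.map (RecursiveIn.comp hψ ComputableIn.fst) ?_)
    exact (Primrec.fst.comp (Primrec.unpair.comp Primrec.snd)).computableIn
  obtain ⟨idx, hidx, hidx'⟩ := exists_computable_oracleFn_eq hθ
  refine ⟨B, hB, fun i j => idx (Nat.pair i j), hidx.comp Primrec₂.natPair.to_comp, ?_⟩
  rintro s A C _ _ i j hi hj ⟨g₀⟩
  obtain ⟨f₀, hf₀⟩ := exists_isIsoCode hi hj g₀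
  obtain ⟨f, hf, hψf⟩ := hpath (Nat.pair i j) ⟨f₀, hf₀.isoTree_seg⟩
  obtain ⟨g, hg⟩ := (isIsoCode_of_isoTree hf).exists_equiv hi hj
  refine ⟨g, fun x y => ?_⟩
  rw [hidx']
  simp only [Nat.unpair_pair, hψf, Part.map_some, Part.mem_bind_iff, Part.mem_some_iff, hGmem]
  constructor
  · rintro ⟨_, ⟨-, hx⟩, rfl⟩
    exact ⟨hi.mem_iff.2 hx, (hg ⟨x, _⟩).symm⟩
  · rintro ⟨hx, rfl⟩
    exact ⟨0, ⟨rfl, hi.mem_iff.1 hx⟩, hg ⟨x, hx⟩⟩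

theorem mainTheorem9 :
    (∀ d b : SetDegree, UniformlyHighForDescendingSequences d → IsPAOver b d →
      UniformlyHighForIsomorphism b) ∧
    (∀ d : SetDegree, UniformlyHighForDescendingSequences d →
      ∀ X : Set ℕ, IsDelta11 X → d.ComputesSet X) := by
  classical
  refine ⟨fun d b => uniformlyHighForIsomorphism_of_isPAOver, fun d hd X hX => ?_⟩
  obtain ⟨D, hD, hfind⟩ := hd.exists_findsDescending
  exact ⟨D, hD, hfind.computableIn_of_isDelta11 hX⟩
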